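/- Let $(M,J)$ be a compact complex surface. A para-hypercomplex structure on a smooth $4$-manifold is a triple $(I,S,T)$ of smooth endomorphism fields of the tangent bundle with $I^2=-\mathrm{Id}$, $S^2=\mathrm{Id}$, $T=IS=-SI$ and vanishing Nijenhuis tensors $N_I=N_S=N_T=0$, where $N_A(X,Y)=[AX,AY]+A^2[X,Y]-A[AX,Y]-A[X,AY]$. A para-hyperhermitian structure $(g,I,S,T)$ consists of a para-hypercomplex structure and a pseudo-Riemannian metric $g$ for which $I,S,T$ are skew-symmetric. Its Lee form is the $1$-form $\theta$ with $d\Omega_i=\theta\wedge\Omega_i$, $i=1,2,3$, where $\Omega_1=g(I\cdot,\cdot)$, $\Omega_2=g(S\cdot,\cdot)$, $\Omega_3=g(T\cdot,\cdot)$; the structure is locally conformally para-hyperkähler if $d\theta=0$. The structure is compatible with $J$ if $I=J$. An infinite-dimensional family of structures is an injective map $v\mapsto(g_v,I_v,S_v,T_v)$ defined on an infinite-dimensional real vector space $V$ such that for every linear map $L:\mathbb R^n\to V$ the tensors of the structure at $L(s)$ depend smoothly on $(s,x)\in\mathbb R^n\times M$. Consider the following surfaces, where $\mathbf H$ is the upper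 half-plane: (1) complex tori $\mathbb C^2/\Lambda$, $\Lambda$ a lattice generated by an $\mathbb R$-basis of $\mathbb C^2$; (2) primary Kodaira surfaces: compact quotients $\mathbb C^2/G$, where $G$ is generated by $\varphi_k(z,w)=(z+a_k,\,w+\bar a_k z+b_k)$, $k=1,2,3,4$, with $a_k,b_k\in\mathbb C$, $a_1=a_2=0$, $\mathrm{Im}(a_3\bar a_4)\ne 0$, $b_1\neq 0$, $b_2\ne 0$; (3) Inoue surfaces of type $S^+$: the quotients of $\mathbb C\times\mathbf H$ by the group generated by $g_0(z,w)=(z+t,\alpha w)$, $g_k(z,w)=(z+b_kw+c_k,\,w+a_k)$ $(k=1,2)$, $g_3(z,w)=\big(z+\tfrac{b_1a_2-b_2a_1}{r},\,w\big)$. Here $t\in\mathbb C$; $N=(n_{ij})$ is an integer matrix with $\det N=1$ and real eigenvalues $\alpha>1$ and $\alpha^{-1}$; $(a_1,a_2)$ and $(b_1,b_2)$ are real eigenvectors for $\alpha$ and $\alpha^{-1}$; $p_1,p_2,r$ are integers, $r\neq0$; and $c_k=n_{k1}c_1+n_{k2}c_2+e_k+\tfrac{b_1a_2-b_2a_1}{r}p_k$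 with $e_k=\tfrac12n_{k1}(n_{k1}-1)a_1b_1+\tfrac12n_{k2}(n_{k2}-1)a_2b_2+n_{k1}n_{k2}b_1a_2$; (4) minimal properly elliptic surfaces of odd first Betti number of the following special type: compact quotients $D/\Gamma$ of $D=\{(x,y)\in\mathbb C^2:\mathrm{Im}(x/y)>0\}$ by a group $\Gamma$ of real linear transformations of positive determinant; (5) quaternionic primary Hopf surfaces $(\mathbb C^2\setminus\{0\})/\mathbb Z$, the generator of $\mathbb Z$ acting by $(z_1,z_2)\mapsto(az_1,\bar az_2)$ with $a\in\mathbb C$, $|a|>1$. (All quotients are taken as complex surfaces, i.e. the projection is a holomorphic local diffeomorphism.) Theorem. Every surface $(M,J)$ in (1)–(5) admits an infinite-dimensional family of para-hyperhermitian structures compatible with $J$. For the surfaces in (1)–(3) the family can be chosen so that its members have pairwise distinct underlying para-hypercomplex structures (in particular no two of its metrics are related by a conformal change within the same para-hypercomplex structure). Every surface in (1) and (2) admits an infinite-dimensional family of para-hyperhermitian structures compatible with $J$, with pairwise distinct underlying para-hypercomplex structures, none of which is locally conformally para-hyperkähler. -/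

import Mathlib

open Set Manifold
open scoped ContDiff

noncomputable section

namespace ParaHH

/-- The model space `ℂ²`. -/
abbrev C2 : Type := ℂ × ℂ

/-! ### Tensor calculus on a smooth real 4-manifold modelled on `ℂ² = ℝ⁴` -/

section Real

variable (M : Type*) [TopologicalSpace M] [ChartedSpace C2 M]

/-- The real tangent space at `x`. -/
abbrev Tan (x : M) : Type := TangentSpace 𝓘(ℝ, C2) x

/-- Endomorphism fields of the tangent bundle (no regularity required). -/
abbrev EndField : Type _ := ∀ x : M, Tan M x →L[ℝ] Tan M x

/-- Fields of real bilinear forms on the tangent bundle (no regularity required). -/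
abbrev BilinField : Type _ := ∀ x : M, Tan M x →L[ℝ] Tan M x →L[ℝ] ℝ

/-- Fields of real linear forms on the tangent bundle (no regularity required). -/
abbrev CovectorField : Type _ := ∀ x : M, Tan M x →L[ℝ] ℝ

/-- Vector fields (no regularity required). -/
abbrev VectField : Type _ := ∀ x : M, Tan M x

variable {M}

/-- The vector field `A X`. -/
def EndField.app (A : EndField M) (X : VectField M) : VectField M := fun x => A x (X x)

/-- The derivative `X f` of a real function along a vector field. -/
def lieD (X : VectField M) (f : M → ℝ) (x : M) : ℝ := mfderiv 𝓘(ℝ, C2) 𝓘(ℝ, ℝ) f x (X x)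

/-- The Lie bracket of vector fields. -/
def bracket (X Y : VectField M) : VectField M := VectorField.mlieBracket 𝓘(ℝ, C2) X Y

/-- The Nijenhuis expression `[AX,AY] + A²[X,Y] - A[AX,Y] - A[X,AY]`. -/
def nijenhuis (A : EndField M) (X Y : VectField M) : VectField M := fun x =>
  bracket (A.app X) (A.app Y) x + A x (A x (bracket X Y x))
    - A x (bracket (A.app X) Y x) - A x (bracket X (A.app Y) x)

/-- The exterior derivative of a 1-form, evaluated on two vector fields. -/
def extD1 (θ : CovectorField M) (X Y : VectField M) (x : M) : ℝ :=
  lieD X (fun y => θ y (Y y)) x - lieD Y (fun y => θ y (X y)) x - θ x (bracket X Y x)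

/-- The exterior derivative of a 2-form, evaluated on three vector fields. -/
def extD2 (Ω : BilinField M) (X Y Z : VectField M) (x : M) : ℝ :=
  lieD X (fun y => Ω y (Y y) (Z y)) x - lieD Y (fun y => Ω y (X y) (Z y)) x
    + lieD Z (fun y => Ω y (X y) (Y y)) x
    - Ω x (bracket X Y x) (Z x) + Ω x (bracket X Z x) (Y x) - Ω x (bracket Y Z x) (X x)

/-- The wedge product of a 1-form and a 2-form, evaluated on three vectors. -/
def wedge12 (θ : CovectorField M) (Ω : BilinField M) (x : M) (u v w : Tan M x) : ℝ :=
  θ x u * Ω x v w - θ x v * Ω x u w + θ x w * Ω x u v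

variable [IsManifold 𝓘(ℝ, C2) ∞ M]

/-- The vector field `X` is smooth at `x`. -/
def SmoothVectAt (X : VectField M) (x : M) : Prop :=
  ContMDiffAt 𝓘(ℝ, C2) (𝓘(ℝ, C2).prod 𝓘(ℝ, C2)) ∞
    (fun y => Bundle.TotalSpace.mk' C2 (E := fun y : M => Tan M y) y (X y)) x

/-- Smoothness of an endomorphism field. -/
def SmoothEnd (A : EndField M) : Prop :=
  ContMDiff 𝓘(ℝ, C2) (𝓘(ℝ, C2).prod 𝓘(ℝ, C2 →L[ℝ] C2)) ∞
    (fun x => Bundle.TotalSpace.mk' (C2 →L[ℝ] C2)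
      (E := fun x : M => Tan M x →L[ℝ] Tan M x) x (A x))

/-- Smoothness of a field of bilinear forms. -/
def SmoothBilin (g : BilinField M) : Prop :=
  ContMDiff 𝓘(ℝ, C2) (𝓘(ℝ, C2).prod 𝓘(ℝ, C2 →L[ℝ] C2 →L[ℝ] ℝ)) ∞
    (fun x => Bundle.TotalSpace.mk' (C2 →L[ℝ] C2 →L[ℝ] ℝ)
      (E := fun x : M => Tan M x →L[ℝ] Tan M x →L[ℝ] ℝ) x (g x))

/-- Smoothness of a 1-form. -/
def SmoothCovector (θ : CovectorField M) : Prop :=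
  ContMDiff 𝓘(ℝ, C2) (𝓘(ℝ, C2).prod 𝓘(ℝ, C2 →L[ℝ] ℝ)) ∞
    (fun x => Bundle.TotalSpace.mk' (C2 →L[ℝ] ℝ)
      (E := fun x : M => Tan M x →L[ℝ] ℝ) x (θ x))

/-- Smoothness of a family of endomorphism fields with parameters in `ℝⁿ`, jointly in the
parameters and the point. -/
def SmoothEndFamily {n : ℕ} (A : (Fin n → ℝ) → EndField M) : Prop :=
  ContMDiff (𝓘(ℝ, Fin n → ℝ).prod 𝓘(ℝ, C2)) (𝓘(ℝ, C2).prod 𝓘(ℝ, C2 →L[ℝ] C2)) ∞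
    (fun p : (Fin n → ℝ) × M => Bundle.TotalSpace.mk' (C2 →L[ℝ] C2)
      (E := fun x : M => Tan M x →L[ℝ] Tan M x) p.2 (A p.1 p.2))

/-- Smoothness of a family of bilinear forms with parameters in `ℝⁿ`, jointly in the
parameters and the point. -/
def SmoothBilinFamily {n : ℕ} (g : (Fin n → ℝ) → BilinField M) : Prop :=
  ContMDiff (𝓘(ℝ, Fin n → ℝ).prod 𝓘(ℝ, C2)) (𝓘(ℝ, C2).prod 𝓘(ℝ, C2 →L[ℝ] C2 →L[ℝ] ℝ)) ∞
    (fun p : (Fin n → ℝ) × M => Bundle.TotalSpace.mk' (C2 →L[ℝ] C2 →L[ℝ] ℝ)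
      (E := fun x : M => Tan M x →L[ℝ] Tan M x →L[ℝ] ℝ) p.2 (g p.1 p.2))

/-- Integrability: the Nijenhuis tensor vanishes. -/
def Integrable (A : EndField M) : Prop :=
  ∀ (x : M) (X Y : VectField M), SmoothVectAt X x → SmoothVectAt Y x → nijenhuis A X Y x = 0

variable (M)

/-- A para-hypercomplex structure `(I, S, T)` on a smooth 4-manifold. -/
structure ParaHypercomplex where
  I : EndField M
  S : EndField M
  T : EndField M
  smooth_I : SmoothEnd I
  smooth_S : SmoothEnd S
  smooth_T : SmoothEnd T
  I_sq : ∀ x u, I x (I x u) = -u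
  S_sq : ∀ x u, S x (S x u) = u
  T_eq : ∀ x u, T x u = I x (S x u)
  anticomm : ∀ x u, I x (S x u) = -S x (I x u)
  integrable_I : Integrable I
  integrable_S : Integrable S
  integrable_T : Integrable T

/-- A para-hyperhermitian structure `(g, I, S, T)` on a smooth 4-manifold: a para-hypercomplex
structure and a pseudo-Riemannian metric (automatically of signature `(2,2)`) for which
`I`, `S`, `T` are skew-symmetric. -/
structure ParaHyperhermitian extends ParaHypercomplex M where
  g : BilinField M
  smooth_g : SmoothBilin g
  symm : ∀ x u v, g x u v = g x v u
  nondegenerate : ∀ x u, (∀ v, g x u v = 0) → u = 0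
  skew_I : ∀ x u v, g x (I x u) v = -g x u (I x v)
  skew_S : ∀ x u v, g x (S x u) v = -g x u (S x v)
  skew_T : ∀ x u v, g x (T x u) v = -g x u (T x v)

variable {M}

/-- The fundamental 2-form `Ω(X,Y) = g(AX,Y)` attached to an endomorphism field `A`. -/
def fundForm (g : BilinField M) (A : EndField M) : BilinField M :=
  fun x => (g x).comp (A x)

/-- `θ` is the Lee form of `Q`: `dΩᵢ = θ ∧ Ωᵢ` for the three fundamental forms
(these identities determine `θ`). -/
def ParaHyperhermitian.IsLeeForm (Q : ParaHyperhermitian M) (θ : CovectorField M) : Prop :=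
  SmoothCovector θ ∧
    ∀ A ∈ ({Q.I, Q.S, Q.T} : Set (EndField M)), ∀ (x : M) (X Y Z : VectField M),
      SmoothVectAt X x → SmoothVectAt Y x → SmoothVectAt Z x →
        extD2 (fundForm Q.g A) X Y Z x = wedge12 θ (fundForm Q.g A) x (X x) (Y x) (Z x)

/-- `Q` is locally conformally para-hyperkähler: its Lee form is closed. -/
def ParaHyperhermitian.IsLCPK (Q : ParaHyperhermitian M) : Prop :=
  ∃ θ : CovectorField M, Q.IsLeeForm θ ∧
    ∀ (x : M) (X Y : VectField M), SmoothVectAt X x → SmoothVectAt Y x → extD1 θ X Y x = 0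

/-- A smooth family of para-hyperhermitian structures with parameters in a real vector space:
its restriction along every linear map from some `ℝⁿ` is jointly smooth. -/
def IsSmoothFamily {V : Type} [AddCommGroup V] [Module ℝ V]
    (Φ : V → ParaHyperhermitian M) : Prop :=
  ∀ (n : ℕ) (L : (Fin n → ℝ) →ₗ[ℝ] V),
    SmoothEndFamily (fun s => (Φ (L s)).I) ∧ SmoothEndFamily (fun s => (Φ (L s)).S) ∧
    SmoothEndFamily (fun s => (Φ (L s)).T) ∧ SmoothBilinFamily (fun s => (Φ (L s)).g)

/-- The class `P` of para-hyperhermitian structures contains an infinite-dimensional family: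
a smooth family of pairwise distinct members of `P`, with parameters in an infinite-dimensional
real vector space. -/
def HasInfDimFamily (P : Set (ParaHyperhermitian M)) : Prop :=
  ∃ (V : Type) (_ : AddCommGroup V) (_ : Module ℝ V), ¬ FiniteDimensional ℝ V ∧
    ∃ Φ : V → ParaHyperhermitian M, IsSmoothFamily Φ ∧ (∀ v, Φ v ∈ P) ∧ Function.Injective Φ

/-- The class `P` of para-hyperhermitian structures contains an infinite-dimensional family
whose members have pairwise distinct underlying para-hypercomplex structures; in particular
no two members are conformal to each other. -/
def HasInfDimFamilyModConformal (P : Set (ParaHyperhermitian M)) : Prop :=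
  ∃ (V : Type) (_ : AddCommGroup V) (_ : Module ℝ V), ¬ FiniteDimensional ℝ V ∧
    ∃ Φ : V → ParaHyperhermitian M, IsSmoothFamily Φ ∧ (∀ v, Φ v ∈ P) ∧
      Function.Injective (fun v => (Φ v).toParaHypercomplex)

end Real

/-! ### Complex surfaces -/

section Complex

/-- A complex surface is in particular a smooth real 4-manifold. -/
instance realManifold (M : Type*) [TopologicalSpace M] [ChartedSpace C2 M]
    [h : IsManifold 𝓘(ℂ, C2) ω M] : IsManifold 𝓘(ℝ, C2) ∞ M := by
  refine isManifold_of_contDiffOn _ _ _ fun e e' he he' => ?_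
  have h1 := (contDiffGroupoid ω 𝓘(ℂ, C2)).compatible (M := M) he he'
  rw [contDiffGroupoid, mem_groupoid_of_pregroupoid] at h1
  have h2 : ContDiffOn ℂ ω (𝓘(ℂ, C2) ∘ (e.symm.trans e') ∘ 𝓘(ℂ, C2).symm)
    (𝓘(ℂ, C2).symm ⁻¹' (e.symm.trans e').source ∩ range 𝓘(ℂ, C2)) := h1.1
  have h3 := (h2.restrict_scalars ℝ).of_le (show (∞ : WithTop ℕ∞) ≤ ω from le_top)
  exact h3

variable (M : Type*) [TopologicalSpace M] [ChartedSpace C2 M]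

/-- The complex structure of a complex surface: multiplication by `i` on tangent vectors (in the
preferred chart at `x`, equivalently in every holomorphic chart). -/
def complexStructure : EndField M := fun _ =>
  (Complex.I • ContinuousLinearMap.id ℝ C2 : C2 →L[ℝ] C2)

/-- The para-hyperhermitian structures on a complex surface `(M, J)` with `I = J`. -/
def compatible [IsManifold 𝓘(ℂ, C2) ω M] : Set (ParaHyperhermitian M) :=
  {Q | Q.I = complexStructure M}

/-- The compatible structures that are not locally conformally para-hyperkähler. -/
def compatibleNonLCPK [IsManifold 𝓘(ℂ, C2) ω M] : Set (ParaHyperhermitian M) :=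
  {Q | Q.I = complexStructure M ∧ ¬ Q.IsLCPK}

/-- `M` is (biholomorphic to) the quotient `U / G`: there is a surjective holomorphic local
diffeomorphism `U → M` whose fibres are the `G`-orbits. -/
def IsQuotient (U : Set C2) (G : Subgroup (Equiv.Perm C2)) : Prop :=
  ∃ π : C2 → M, IsLocalDiffeomorphOn 𝓘(ℂ, C2) 𝓘(ℂ, C2) ω π U ∧ π '' U = univ ∧
    ∀ p ∈ U, ∀ q ∈ U, π p = π q ↔ ∃ g ∈ G, g p = q

/-- A complex torus `ℂ² / Λ`, with `Λ` the lattice generated by a real basis of `ℂ²`. -/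
def IsComplexTorus : Prop :=
  ∃ τ : Module.Basis (Fin 4) ℝ C2,
    IsQuotient M univ (Subgroup.closure {g | ∃ k, ∀ p, g p = p + τ k})

/-- A primary Kodaira surface: a quotient of `ℂ²` by the group generated by the four affine
transformations `(z, w) ↦ (z + aₖ, w + āₖ z + bₖ)`, with `a₁ = a₂ = 0`, `Im (a₃ ā₄) ≠ 0` and
`b₁, b₂ ≠ 0` (indices are shifted by one below). -/
def IsPrimaryKodaira : Prop :=
  ∃ a b : Fin 4 → ℂ, a 0 = 0 ∧ a 1 = 0 ∧ (a 2 * (starRingEnd ℂ) (a 3)).im ≠ 0 ∧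
    b 0 ≠ 0 ∧ b 1 ≠ 0 ∧
    IsQuotient M univ (Subgroup.closure
      {g | ∃ k, ∀ z w : ℂ, g (z, w) = (z + a k, w + (starRingEnd ℂ) (a k) * z + b k)})

/-- An Inoue surface of type `S⁺`: a quotient of `ℂ × H` by the group generated by
`g₀(z,w) = (z + t, α w)`, `gₖ(z,w) = (z + bₖ w + cₖ, w + aₖ)` for `k = 1, 2`, and
`g₃(z,w) = (z + (b₁a₂ - b₂a₁)/r, w)`. -/
def IsInoueSPlus : Prop :=
  ∃ (N : Matrix (Fin 2) (Fin 2) ℤ) (α : ℝ) (a b c : Fin 2 → ℝ) (m : Fin 2 → ℤ) (r : ℤ) (t : ℂ),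
    N.det = 1 ∧ 1 < α ∧ a ≠ 0 ∧ b ≠ 0 ∧ r ≠ 0 ∧
    (N.map (Int.cast : ℤ → ℝ)).mulVec a = α • a ∧
    (N.map (Int.cast : ℤ → ℝ)).mulVec b = α⁻¹ • b ∧
    (∀ k, c k = N k 0 * c 0 + N k 1 * c 1
      + ((1 / 2 : ℝ) * N k 0 * (N k 0 - 1) * a 0 * b 0
        + (1 / 2 : ℝ) * N k 1 * (N k 1 - 1) * a 1 * b 1 + N k 0 * N k 1 * b 0 * a 1)
      + (b 0 * a 1 - b 1 * a 0) / r * m k) ∧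
    IsQuotient M {p | 0 < p.2.im} (Subgroup.closure
      ({g | ∀ z w : ℂ, g (z, w) = (z + t, (α : ℂ) * w)} ∪
        {g | ∃ k, ∀ z w : ℂ, g (z, w) = (z + (b k : ℂ) * w + (c k : ℂ), w + (a k : ℂ))} ∪
        {g | ∀ z w : ℂ, g (z, w) = (z + (((b 0 * a 1 - b 1 * a 0) / r : ℝ) : ℂ), w)}))

/-- A minimal properly elliptic surface of odd first Betti number and of real type: a quotient of
`D = {(x, y) : Im (x / y) > 0}` by a group of real linear transformations of positive
determinant. -/
def IsRealProperlyElliptic : Prop :=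
  ∃ Γ : Subgroup (GL (Fin 2) ℝ), (∀ L ∈ Γ, 0 < (L : Matrix (Fin 2) (Fin 2) ℝ).det) ∧
    IsQuotient M {p | 0 < (p.1 / p.2).im} (Subgroup.closure
      {g | ∃ L ∈ Γ, ∀ x y : ℂ, g (x, y) =
        (((L 0 0 : ℝ) : ℂ) * x + ((L 0 1 : ℝ) : ℂ) * y,
          ((L 1 0 : ℝ) : ℂ) * x + ((L 1 1 : ℝ) : ℂ) * y)})

/-- A quaternionic primary Hopf surface: the quotient of `ℂ² ∖ {0}` by the group generated by
`(z₁, z₂) ↦ (a z₁, ā z₂)`, where `|a| > 1`. -/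
def IsQuaternionicHopf : Prop :=
  ∃ a : ℂ, 1 < ‖a‖ ∧
    IsQuotient M {0}ᶜ (Subgroup.closure
      {g | ∀ z w : ℂ, g (z, w) = (a * z, (starRingEnd ℂ) a * w)})

end Complex

end ParaHH

end

/-!
All the structures are produced by descent. A surface of each of the five types is covered by an
open set `U ⊆ ℂ²`, with affine deck transformations, so it is enough to write down on `U` a
para-hyperhermitian structure `(g, i, S, iS)` that the deck transformations preserve
(`FlatPHH.toPHH`, `IsQuotientCover.endDescends`, `IsQuotientCover.bilinDescends`). A single model
serves in every case. For functions `q` and `φ` of the first coordinate `z`, with `|q| = 1` and `φ`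
real, and a nowhere vanishing function `c`, put

* `S (a, b) = (q² ā, i φ q ā + b̄)`,
* `g = c (φ Re (a ā') + Re (i q (ā b' + b ā')))`.

Then `S² = 1`, `S` anticommutes with `i`, and the Nijenhuis tensors of `S` and `iS` vanish because
their components are multiples of the derivative of the identity `S² = 1` with respect to `z̄`
(`flatNijenhuis_modelS`). The map `(z, w) ↦ (l z + a, w + μ z + b)`, with `l` real, preserves the
model as soon as `q` is invariant, `l φ` transforms into `φ + 2 Im (μ q)`, and `l c` transforms into
`c` (`isAffineSymm_triangular`); when `q = 1` and `φ = 0`, real linear maps preserve `S` and multiply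
`g / c` by their determinant (`isAffineSymm_real`).

* Tori and primary Kodaira surfaces: in suitable coordinates there is a real linear form `ℓ` of `z`
  taking integer values on the translation parts in `z` of the generators. Take
  `q = exp (i sin (2π ℓ))`, `φ = P (cos (2π ℓ)) + 2 ε Im (z̄ q)` and `c = 1`, with `P` any real
  polynomial and `ε = 0` or `1` respectively.
* Inoue surfaces: with the coordinate of the upper half-plane in the role of `z` and `y = Im z`, take
  `q = 1`, `φ = P (cos (2π log y / log α)) / y` and `c = 1 / y`.
* Elliptic and Hopf surfaces: the deck group acts by real linear maps, after a linear change of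
  coordinates in the Hopf case. Take `q = 1`, `φ = 0` and `c = exp (P ∘ f) / d`, where `d` is
  `Im (z w̄)`, respectively `|z|² + |w|²`, and `f` is a smooth function on the surface with infinitely
  many values.

In every case the family is parametrized by the polynomials `P`. Since `φ` is visible in `S` and `c`
in `g`, different polynomials give different para-hypercomplex structures in the first two cases
and different metrics in the last.

For tori and Kodaira surfaces the fundamental forms of `S` and `T` are the real and imaginary parts
of `i q̄ dz ∧ dw`, which determine the Lee form `θ`: with `v = sin (2π ℓ)` and `z = x + i y`, one finds
`θ (∂ₓ) = v_y` and `θ (∂_y) = -v_x`. Hence `dθ` is minus the Laplacian of `v` times `dx ∧ dy` on these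
vectors, which is not zero (`not_isLCPK_of_phase`).
-/

noncomputable section

namespace ParaHH

open Filter Topology

/-! ### Coverings by open subsets of `ℂ²` -/

lemma contMDiffOn_real_of_complex {N N' : Type*} [TopologicalSpace N] [ChartedSpace C2 N]
    [TopologicalSpace N'] [ChartedSpace C2 N'] {f : N → N'} {s : Set N}
    (hf : ContMDiffOn 𝓘(ℂ, C2) 𝓘(ℂ, C2) ω f s) : ContMDiffOn 𝓘(ℝ, C2) 𝓘(ℝ, C2) ∞ f s := by
  intro x hx
  have h := contMDiffWithinAt_iff.1 (hf x hx)
  refine contMDiffWithinAt_iff.2 ⟨h.1, ?_⟩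
  exact (h.2.restrict_scalars ℝ).of_le le_top

lemma isLocalDiffeomorphAt_real {N N' : Type*} [TopologicalSpace N] [ChartedSpace C2 N]
    [TopologicalSpace N'] [ChartedSpace C2 N'] {f : N → N'} {x : N}
    (hf : IsLocalDiffeomorphAt 𝓘(ℂ, C2) 𝓘(ℂ, C2) ω f x) :
    IsLocalDiffeomorphAt 𝓘(ℝ, C2) 𝓘(ℝ, C2) ∞ f x := by
  obtain ⟨Φ, hx, hΦ⟩ := hf
  exact ⟨⟨Φ.toPartialEquiv, Φ.open_source, Φ.open_target,
    contMDiffOn_real_of_complex Φ.contMDiffOn_toFun,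
    contMDiffOn_real_of_complex Φ.contMDiffOn_invFun⟩, hx, hΦ⟩

variable {M : Type*} [TopologicalSpace M] [ChartedSpace C2 M]

/-- The real differential at `p` of a map `π : ℂ² → M`, written in the preferred chart at `π p`. -/
def dcov (π : C2 → M) (p : C2) : C2 →L[ℝ] C2 := mfderiv 𝓘(ℝ, C2) 𝓘(ℝ, C2) π p

lemma dcov_complex_linear {π : C2 → M} {p : C2}
    (h : MDifferentiableAt 𝓘(ℂ, C2) 𝓘(ℂ, C2) π p) (u : C2) :
    dcov π p (Complex.I • u) = Complex.I • dcov π p u := by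
  have h1 := h.hasMFDerivAt
  have h2 : HasMFDerivAt 𝓘(ℝ, C2) 𝓘(ℝ, C2) π p
      ((mfderiv 𝓘(ℂ, C2) 𝓘(ℂ, C2) π p : C2 →L[ℂ] C2).restrictScalars ℝ) :=
    ⟨h1.1, HasFDerivWithinAt.restrictScalars ℝ h1.2⟩
  have h3 : dcov π p = (mfderiv 𝓘(ℂ, C2) 𝓘(ℂ, C2) π p : C2 →L[ℂ] C2).restrictScalars ℝ :=
    h2.mfderiv
  rw [h3]
  exact (mfderiv 𝓘(ℂ, C2) 𝓘(ℂ, C2) π p : C2 →L[ℂ] C2).map_smul _ _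

section Trivialization

variable [IsManifold 𝓘(ℝ, C2) ∞ M]

/-- The trivialization of the tangent bundle centred at `x₀`, on the fibre over `y`, with the
fibre identified with `ℂ²`. -/
def trivL (x₀ y : M) : C2 →L[ℝ] C2 :=
  have : IsManifold 𝓘(ℝ, C2) 1 M := IsManifold.of_le (n := ∞) (by simp)
  (trivializationAt C2 (TangentSpace 𝓘(ℝ, C2)) x₀).continuousLinearMapAt ℝ y

/-- The inverse of `trivL x₀ y`, for `y` in the domain of the chart at `x₀`. -/
def trivR (x₀ y : M) : C2 →L[ℝ] C2 :=
  have : IsManifold 𝓘(ℝ, C2) 1 M := IsManifold.of_le (n := ∞) (by simp)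
  (trivializationAt C2 (TangentSpace 𝓘(ℝ, C2)) x₀).symmL ℝ y

lemma trivL_trivR {x₀ y : M} (hy : y ∈ (chartAt C2 x₀).source) (u : C2) :
    trivL x₀ y (trivR x₀ y u) = u := by
  have : IsManifold 𝓘(ℝ, C2) 1 M := IsManifold.of_le (n := ∞) (by simp)
  exact (trivializationAt C2 (TangentSpace 𝓘(ℝ, C2)) x₀).continuousLinearMapAt_symmL
    (by simpa using hy) u

lemma trivR_trivL {x₀ y : M} (hy : y ∈ (chartAt C2 x₀).source) (u : C2) :
    trivR x₀ y (trivL x₀ y u) = u := by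
  have : IsManifold 𝓘(ℝ, C2) 1 M := IsManifold.of_le (n := ∞) (by simp)
  exact (trivializationAt C2 (TangentSpace 𝓘(ℝ, C2)) x₀).symmL_continuousLinearMapAt
    (by simpa using hy) u

lemma isInvertible_trivL {x₀ y : M} (hy : y ∈ (chartAt C2 x₀).source) :
    (trivL x₀ y).IsInvertible :=
  .of_inverse (g := trivR x₀ y) (ContinuousLinearMap.ext (trivL_trivR hy))
    (ContinuousLinearMap.ext (trivR_trivL hy))

lemma trivL_inverse {x₀ y : M} (hy : y ∈ (chartAt C2 x₀).source) :
    (trivL x₀ y).inverse = trivR x₀ y :=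
  ContinuousLinearMap.inverse_eq (ContinuousLinearMap.ext (trivL_trivR hy))
    (ContinuousLinearMap.ext (trivR_trivL hy))

end Trivialization

/-- `π : U → M` is a surjective smooth local diffeomorphism, with `U` open in `ℂ²`. The map `π` is
defined on all of `ℂ²`, with arbitrary values outside `U`. -/
structure IsCover (π : C2 → M) (U : Set C2) : Prop where
  isOpen : IsOpen U
  locDiff : ∀ p ∈ U, IsLocalDiffeomorphAt 𝓘(ℝ, C2) 𝓘(ℝ, C2) ∞ π p
  surj : ∀ x, ∃ p ∈ U, π p = x

namespace IsCover

variable [IsManifold 𝓘(ℝ, C2) ∞ M] {π : C2 → M} {U : Set C2} (h : IsCover π U)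
include h

omit [IsManifold 𝓘(ℝ, C2) ∞ M] in
lemma contMDiffAt {p : C2} (hp : p ∈ U) : ContMDiffAt 𝓘(ℝ, C2) 𝓘(ℝ, C2) ∞ π p :=
  (h.locDiff p hp).contMDiffAt

omit [IsManifold 𝓘(ℝ, C2) ∞ M] in
lemma mdifferentiableAt {p : C2} (hp : p ∈ U) : MDifferentiableAt 𝓘(ℝ, C2) 𝓘(ℝ, C2) π p :=
  (h.contMDiffAt hp).mdifferentiableAt (by simp)

lemma isInvertible {p : C2} (hp : p ∈ U) : (dcov π p).IsInvertible := by
  have : IsManifold 𝓘(ℝ, C2) 1 M := IsManifold.of_le (n := ∞) (by simp)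
  exact ⟨(h.locDiff p hp).mfderivToContinuousLinearEquiv (by simp), rfl⟩

omit [IsManifold 𝓘(ℝ, C2) ∞ M] in
/-- A local section of the covering near `π p`. -/
lemma exists_section {p : C2} (hp : p ∈ U) : ∃ ψ : M → C2,
    ContMDiffAt 𝓘(ℝ, C2) 𝓘(ℝ, C2) ∞ ψ (π p) ∧ ψ (π p) = p ∧
      (∀ᶠ y in 𝓝 (π p), ψ y ∈ U ∧ π (ψ y) = y) ∧ ∀ᶠ q in 𝓝 p, ψ (π q) = q := by
  have hl := h.locDiff p hp
  have h1 : hl.localInverse (π p) = p := hl.localInverse_left_inv hl.localInverse_mem_target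
  refine ⟨hl.localInverse, hl.localInverse_contMDiffAt, h1, ?_, ?_⟩
  · have h2 := hl.localInverse_contMDiffAt.continuousAt
    have h3 : ∀ᶠ y in 𝓝 (π p), hl.localInverse y ∈ U :=
      h2 (by rw [h1]; exact h.isOpen.mem_nhds hp)
    exact h3.and hl.localInverse_eventuallyEq_right
  · exact hl.localInverse_eventuallyEq_left

/-- The coordinate expression of `dπ` in the trivialization centred at `x₀`. -/
lemma triv_comp_dcov {x₀ : M} {p : C2} (hp : p ∈ U) (hx : π p ∈ (chartAt C2 x₀).source) :
    (trivL x₀ (π p)).comp (dcov π p) = fderiv ℝ (extChartAt 𝓘(ℝ, C2) x₀ ∘ π) p := by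
  have : IsManifold 𝓘(ℝ, C2) 1 M := IsManifold.of_le (n := ∞) (by simp)
  rw [trivL, TangentBundle.continuousLinearMapAt_trivializationAt hx, ← mfderiv_eq_fderiv,
    mfderiv_comp p (mdifferentiableAt_extChartAt hx) (h.mdifferentiableAt hp)]
  rfl

lemma inverse_comp_triv {x₀ : M} {p : C2} (hp : p ∈ U) (hx : π p ∈ (chartAt C2 x₀).source) :
    (dcov π p).inverse.comp (trivR x₀ (π p)) =
      (fderiv ℝ (extChartAt 𝓘(ℝ, C2) x₀ ∘ π) p).inverse := by
  rw [← h.triv_comp_dcov hp hx, (isInvertible_trivL hx).inverse_comp_of_left, trivL_inverse hx]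

omit [IsManifold 𝓘(ℝ, C2) ∞ M] in
lemma eventually_source {x₀ : M} {p : C2} (hp : p ∈ U) (hx : π p = x₀) :
    ∀ᶠ q in 𝓝 p, q ∈ U ∧ π q ∈ (chartAt C2 x₀).source := by
  subst hx
  exact Filter.Eventually.and (h.isOpen.mem_nhds hp)
    ((h.contMDiffAt hp).continuousAt ((chartAt C2 _).open_source.mem_nhds (mem_chart_source _ _)))

omit [IsManifold 𝓘(ℝ, C2) ∞ M] in
lemma contDiffAt_chart {p : C2} (hp : p ∈ U) :
    ContDiffAt ℝ ∞ (extChartAt 𝓘(ℝ, C2) (π p) ∘ π) p := by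
  rw [← contMDiffAt_iff_contDiffAt]
  exact (contMDiffAt_extChartAt (n := ∞)).comp p (h.contMDiffAt hp)

omit [IsManifold 𝓘(ℝ, C2) ∞ M] in
lemma contDiffAt_fderiv_chart {p : C2} (hp : p ∈ U) :
    ContDiffAt ℝ ∞ (fderiv ℝ (extChartAt 𝓘(ℝ, C2) (π p) ∘ π)) p :=
  (h.contDiffAt_chart hp).fderiv_right (by simp)

lemma contDiffAt_fderiv_chart_inverse {p : C2} (hp : p ∈ U) :
    ContDiffAt ℝ ∞ (fun q => (fderiv ℝ (extChartAt 𝓘(ℝ, C2) (π p) ∘ π) q).inverse) p := by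
  refine ContDiffAt.comp p (ContinuousLinearMap.IsInvertible.contDiffAt_map_inverse ?_)
    (h.contDiffAt_fderiv_chart hp)
  rw [← h.triv_comp_dcov hp (mem_chart_source _ _)]
  exact (isInvertible_trivL (mem_chart_source _ _)).comp (h.isInvertible hp)

end IsCover

/-! ### Descent of tensor fields along a covering -/

section Push

variable {M : Type*} [TopologicalSpace M] [ChartedSpace C2 M]

/-- The endomorphism field on `M` transported from `U` through the points `σ x` over `x`. The
section `σ` need not be continuous: the result is independent of it for fields that descend. -/
def pushEnd (π : C2 → M) (σ : M → C2) (A : C2 → C2 →L[ℝ] C2) : EndField M := fun x =>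
  (dcov π (σ x)).comp ((A (σ x)).comp (dcov π (σ x)).inverse)

/-- The field of bilinear forms on `M` transported from `U` through the points `σ x` over `x`. -/
def pushBilin (π : C2 → M) (σ : M → C2) (g : C2 → C2 →L[ℝ] C2 →L[ℝ] ℝ) : BilinField M := fun x =>
  (g (σ x)).bilinearComp (dcov π (σ x)).inverse (dcov π (σ x)).inverse

/-- The endomorphism field `A` on `U` descends along `π`: any two points over the same point of `M`
induce the same endomorphism there. -/
def EndDescends (π : C2 → M) (U : Set C2) (A : C2 → C2 →L[ℝ] C2) : Prop :=
  ∀ p ∈ U, ∀ q ∈ U, π p = π q → ∀ u, dcov π q (A q ((dcov π q).inverse u)) =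
    dcov π p (A p ((dcov π p).inverse u))

/-- The field `g` of bilinear forms on `U` descends along `π`. -/
def BilinDescends (π : C2 → M) (U : Set C2) (g : C2 → C2 →L[ℝ] C2 →L[ℝ] ℝ) : Prop :=
  ∀ p ∈ U, ∀ q ∈ U, π p = π q → ∀ u v, g q ((dcov π q).inverse u) ((dcov π q).inverse v) =
    g p ((dcov π p).inverse u) ((dcov π p).inverse v)

variable {π : C2 → M} {U : Set C2} {σ : M → C2}

lemma pushEnd_apply {A : C2 → C2 →L[ℝ] C2} (hσ : ∀ x, σ x ∈ U ∧ π (σ x) = x)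
    (hA : EndDescends π U A) {p : C2} (hp : p ∈ U) (u : C2) :
    pushEnd π σ A (π p) u = dcov π p (A p ((dcov π p).inverse u)) :=
  hA p hp (σ (π p)) (hσ _).1 (hσ _).2.symm u

lemma pushBilin_apply {g : C2 → C2 →L[ℝ] C2 →L[ℝ] ℝ} (hσ : ∀ x, σ x ∈ U ∧ π (σ x) = x)
    (hg : BilinDescends π U g) {p : C2} (hp : p ∈ U) (u v : C2) :
    pushBilin π σ g (π p) u v = g p ((dcov π p).inverse u) ((dcov π p).inverse v) :=
  hg p hp (σ (π p)) (hσ _).1 (hσ _).2.symm u v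

variable [IsManifold 𝓘(ℝ, C2) ∞ M] (h : IsCover π U)

include h

omit [IsManifold 𝓘(ℝ, C2) ∞ M] in
/-- A function on `ℝⁿ × M` that lifts to a smooth function of the parameters and of the point of
the covering is smooth. -/
lemma contMDiffAt_of_lift {n : ℕ} {F : Type*} [NormedAddCommGroup F] [NormedSpace ℝ F]
    {p : C2} (hp : p ∈ U) {s : Fin n → ℝ} {f : (Fin n → ℝ) × M → F} {G : (Fin n → ℝ) × C2 → F}
    (hG : ContDiffAt ℝ ∞ G (s, p))
    (hf : ∀ᶠ q in 𝓝 p, ∀ t, f (t, π q) = G (t, q)) :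
    ContMDiffAt (𝓘(ℝ, Fin n → ℝ).prod 𝓘(ℝ, C2)) 𝓘(ℝ, F) ∞ f (s, π p) := by
  obtain ⟨ψ, hψ, hψp, hψr, hψl⟩ := h.exists_section hp
  have h1 : ContMDiffAt (𝓘(ℝ, Fin n → ℝ).prod 𝓘(ℝ, C2)) 𝓘(ℝ, (Fin n → ℝ) × C2) ∞
      (fun z : (Fin n → ℝ) × M => (z.1, ψ z.2)) (s, π p) :=
    ContMDiffAt.prodMk_space contMDiffAt_fst (ContMDiffAt.comp (s, π p) hψ contMDiffAt_snd)
  have h2 : ContMDiffAt 𝓘(ℝ, (Fin n → ℝ) × C2) 𝓘(ℝ, F) ∞ G (s, ψ (π p)) := by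
    rw [hψp]; exact hG.contMDiffAt
  refine (ContMDiffAt.comp (s, π p) h2 h1).congr_of_eventuallyEq ?_
  have h3 : ∀ᶠ y in 𝓝 (π p), (∀ t, f (t, π (ψ y)) = G (t, ψ y)) ∧ π (ψ y) = y := by
    have h4 : Tendsto ψ (𝓝 (π p)) (𝓝 p) := by
      have := hψ.continuousAt.tendsto
      rwa [hψp] at this
    exact (h4.eventually hf).and (hψr.mono fun y hy => hy.2)
  have h5 : Tendsto (Prod.snd : (Fin n → ℝ) × M → M) (𝓝 (s, π p)) (𝓝 (π p)) :=
    continuous_snd.tendsto _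
  filter_upwards [h5.eventually h3] with z hz
  have := hz.1 z.1
  rw [hz.2] at this
  exact this

/-- The coordinate expression of the descended endomorphism field near `x₀` lifts to a function on
the covering that involves only `A` and the map `π` read in the chart at `x₀`. -/
lemma inCoordinates_pushEnd (hσ : ∀ x, σ x ∈ U ∧ π (σ x) = x)
    {A : C2 → C2 →L[ℝ] C2} (hA : EndDescends π U A) {x₀ : M} {q : C2} (hq : q ∈ U)
    (hx : π q ∈ (chartAt C2 x₀).source) :
    ContinuousLinearMap.inCoordinates C2 (fun x : M => Tan M x) C2 (fun x : M => Tan M x)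
      x₀ (π q) x₀ (π q) (pushEnd π σ A (π q)) =
    (fderiv ℝ (extChartAt 𝓘(ℝ, C2) x₀ ∘ π) q).comp ((A q).comp
      (fderiv ℝ (extChartAt 𝓘(ℝ, C2) x₀ ∘ π) q).inverse) := by
  rw [← h.inverse_comp_triv hq hx, ← h.triv_comp_dcov hq hx]
  refine ContinuousLinearMap.ext fun u => ?_
  change trivL x₀ (π q) (pushEnd π σ A (π q) (trivR x₀ (π q) u)) = _
  rw [pushEnd_apply hσ hA hq]
  rfl

lemma smoothEndFamily_pushEnd (hσ : ∀ x, σ x ∈ U ∧ π (σ x) = x) {n : ℕ}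
    {A : (Fin n → ℝ) → C2 → C2 →L[ℝ] C2} (hA : ∀ s, EndDescends π U (A s))
    (hs : ContDiffOn ℝ ∞ (fun z : (Fin n → ℝ) × C2 => A z.1 z.2) (univ ×ˢ U)) :
    SmoothEndFamily (fun s => pushEnd π σ (A s)) := by
  rintro ⟨s, x⟩
  obtain ⟨p, hp, rfl⟩ := h.surj x
  have hE : ContDiffAt ℝ ∞ (fun z : (Fin n → ℝ) × C2 =>
      fderiv ℝ (extChartAt 𝓘(ℝ, C2) (π p) ∘ π) z.2) (s, p) :=
    (h.contDiffAt_fderiv_chart hp).snd'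
  have hE' : ContDiffAt ℝ ∞ (fun z : (Fin n → ℝ) × C2 =>
      (fderiv ℝ (extChartAt 𝓘(ℝ, C2) (π p) ∘ π) z.2).inverse) (s, p) :=
    (h.contDiffAt_fderiv_chart_inverse hp).snd'
  have hA' : ContDiffAt ℝ ∞ (fun z : (Fin n → ℝ) × C2 => A z.1 z.2) (s, p) :=
    hs.contDiffAt ((isOpen_univ.prod h.isOpen).mem_nhds ⟨mem_univ _, hp⟩)
  have key := contMDiffAt_of_lift h hp (s := s)
    (f := fun z : (Fin n → ℝ) × M => ContinuousLinearMap.inCoordinates C2 (fun x : M => Tan M x)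
      C2 (fun x : M => Tan M x) (π p) z.2 (π p) z.2 (pushEnd π σ (A z.1) z.2))
    (hE.clm_comp (hA'.clm_comp hE'))
    ((h.eventually_source hp rfl).mono fun q hq t => inCoordinates_pushEnd h hσ (hA t) hq.1 hq.2)
  exact (contMDiffAt_hom_bundle _).2 ⟨contMDiffAt_snd, key⟩

/-- The analogue of `inCoordinates_pushEnd` for bilinear forms. -/
lemma inCoordinates_pushBilin (hσ : ∀ x, σ x ∈ U ∧ π (σ x) = x)
    {g : C2 → C2 →L[ℝ] C2 →L[ℝ] ℝ} (hg : BilinDescends π U g) {x₀ : M} {q : C2} (hq : q ∈ U)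
    (hx : π q ∈ (chartAt C2 x₀).source) :
    ContinuousLinearMap.inCoordinates C2 (fun x : M => Tan M x) (C2 →L[ℝ] ℝ)
      (fun x : M => Tan M x →L[ℝ] ℝ) x₀ (π q) x₀ (π q) (pushBilin π σ g (π q)) =
    ((ContinuousLinearMap.compL ℝ C2 C2 ℝ).flip
        (fderiv ℝ (extChartAt 𝓘(ℝ, C2) x₀ ∘ π) q).inverse).comp
        ((g q).comp (fderiv ℝ (extChartAt 𝓘(ℝ, C2) x₀ ∘ π) q).inverse) := by
  have : IsManifold 𝓘(ℝ, C2) 1 M := IsManifold.of_le (n := ∞) (by simp)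
  rw [← h.inverse_comp_triv hq hx]
  refine ContinuousLinearMap.ext fun u => ContinuousLinearMap.ext fun v => ?_
  have hb : π q ∈ (trivializationAt C2 (TangentSpace 𝓘(ℝ, C2)) x₀).baseSet := by
    simpa using hx
  refine (inCoordinates_apply_eq₂ (E₃ := fun _ : M => ℝ)
    hb hb (mem_univ _)).trans ?_
  have e4 : ∀ y : ℝ, (trivializationAt ℝ (Bundle.Trivial M ℝ) x₀).linearMapAt ℝ (π q) y = y := by
    intro y
    simp
  refine (e4 _).trans ?_
  have e3 : ∀ w : C2, (trivializationAt C2 (TangentSpace 𝓘(ℝ, C2)) x₀).symm (π q) w =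
      trivR x₀ (π q) w := fun w =>
    ((trivializationAt C2 (TangentSpace 𝓘(ℝ, C2)) x₀).symmL_apply (R := ℝ) hb w).symm
  rw [e3 u, e3 v]
  change pushBilin π σ g (π q) (trivR x₀ (π q) u) (trivR x₀ (π q) v) = _
  rw [pushBilin_apply hσ hg hq]
  rfl

lemma smoothBilinFamily_pushBilin (hσ : ∀ x, σ x ∈ U ∧ π (σ x) = x) {n : ℕ}
    {g : (Fin n → ℝ) → C2 → C2 →L[ℝ] C2 →L[ℝ] ℝ} (hg : ∀ s, BilinDescends π U (g s))
    (hs : ContDiffOn ℝ ∞ (fun z : (Fin n → ℝ) × C2 => g z.1 z.2) (univ ×ˢ U)) :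
    SmoothBilinFamily (fun s => pushBilin π σ (g s)) := by
  rintro ⟨s, x⟩
  obtain ⟨p, hp, rfl⟩ := h.surj x
  have hE' : ContDiffAt ℝ ∞ (fun z : (Fin n → ℝ) × C2 =>
      (fderiv ℝ (extChartAt 𝓘(ℝ, C2) (π p) ∘ π) z.2).inverse) (s, p) :=
    (h.contDiffAt_fderiv_chart_inverse hp).snd'
  have hg' : ContDiffAt ℝ ∞ (fun z : (Fin n → ℝ) × C2 => g z.1 z.2) (s, p) :=
    hs.contDiffAt ((isOpen_univ.prod h.isOpen).mem_nhds ⟨mem_univ _, hp⟩)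
  have hF : ContDiffAt ℝ ∞ (fun z : (Fin n → ℝ) × C2 => (ContinuousLinearMap.compL ℝ C2 C2 ℝ).flip
        (fderiv ℝ (extChartAt 𝓘(ℝ, C2) (π p) ∘ π) z.2).inverse) (s, p) :=
    contDiffAt_const.clm_apply hE'
  have key := contMDiffAt_of_lift h hp (s := s)
    (f := fun z : (Fin n → ℝ) × M => ContinuousLinearMap.inCoordinates C2 (fun x : M => Tan M x)
      (C2 →L[ℝ] ℝ) (fun x : M => Tan M x →L[ℝ] ℝ) (π p) z.2 (π p) z.2 (pushBilin π σ (g z.1) z.2))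
    (hF.clm_comp (hg'.clm_comp hE'))
    ((h.eventually_source hp rfl).mono fun q hq t => inCoordinates_pushBilin h hσ (hg t) hq.1 hq.2)
  exact (contMDiffAt_hom_bundle _).2 ⟨contMDiffAt_snd, key⟩

lemma smoothEnd_pushEnd (hσ : ∀ x, σ x ∈ U ∧ π (σ x) = x)
    {A : C2 → C2 →L[ℝ] C2} (hA : EndDescends π U A) (hs : ContDiffOn ℝ ∞ A U) :
    SmoothEnd (pushEnd π σ A) := by
  have h1 := smoothEndFamily_pushEnd h hσ (n := 0) (A := fun _ => A) (fun _ => hA)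
    (hs.comp contDiffOn_snd fun z hz => hz.2)
  exact ContMDiff.comp h1 (contMDiff_const (c := 0) |>.prodMk contMDiff_id)

lemma smoothBilin_pushBilin (hσ : ∀ x, σ x ∈ U ∧ π (σ x) = x)
    {g : C2 → C2 →L[ℝ] C2 →L[ℝ] ℝ} (hg : BilinDescends π U g) (hs : ContDiffOn ℝ ∞ g U) :
    SmoothBilin (pushBilin π σ g) := by
  have h1 := smoothBilinFamily_pushBilin h hσ (n := 0) (g := fun _ => g) (fun _ => hg)
    (hs.comp contDiffOn_snd fun z hz => hz.2)
  exact ContMDiff.comp h1 (contMDiff_const (c := 0) |>.prodMk contMDiff_id)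

end Push

/-! ### Vector fields, brackets and derivatives on a covering -/

section Lift

variable {M : Type*} [TopologicalSpace M] [ChartedSpace C2 M]

/-- The lift along `π` of a vector field on `M`. -/
def liftV (π : C2 → M) (X : VectField M) (p : C2) : C2 := (dcov π p).inverse (X (π p))

/-- The Nijenhuis tensor of an endomorphism field `A` of `ℂ²`, in terms of the derivative of `A`: its
value on constant vector fields `u`, `v`. -/
def flatNijenhuis (A : C2 → C2 →L[ℝ] C2) (p u v : C2) : C2 :=
  fderiv ℝ A p (A p u) v - fderiv ℝ A p (A p v) u
    + A p (fderiv ℝ A p v u) - A p (fderiv ℝ A p u v)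

variable {π : C2 → M} {U : Set C2} {σ : M → C2}
variable [IsManifold 𝓘(ℝ, C2) ∞ M] (h : IsCover π U)

include h

lemma dcov_liftV {p : C2} (hp : p ∈ U) (X : VectField M) : dcov π p (liftV π X p) = X (π p) :=
  (h.isInvertible hp).self_apply_inverse _

/-- The lift of a vector field is its pullback, hence smooth. -/
lemma contDiffAt_liftV {p : C2} (hp : p ∈ U) {X : VectField M} (hX : SmoothVectAt X (π p)) :
    ContDiffAt ℝ ∞ (liftV π X) p := by
  have : IsManifold 𝓘(ℝ, C2) 1 M := IsManifold.of_le (n := ∞) (by simp)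
  exact contMDiffAt_vectorSpace_iff_contDiffAt.1
    (ContMDiffAt.mpullback_vectorField_preimage (m := ∞) (n := ∞) hX (h.contMDiffAt hp)
      (h.isInvertible hp) (by simp))

lemma liftV_bracket {p : C2} (hp : p ∈ U) {X Y : VectField M} (hX : SmoothVectAt X (π p))
    (hY : SmoothVectAt Y (π p)) : liftV π (bracket X Y) p =
      fderiv ℝ (liftV π Y) p (liftV π X p) - fderiv ℝ (liftV π X) p (liftV π Y p) := by
  have hle : (2 : WithTop ℕ∞) ≤ ∞ :=
    WithTop.coe_le_coe.2 (le_top : (2 : ℕ∞) ≤ ⊤)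
  have : IsManifold 𝓘(ℝ, C2) (minSmoothness ℝ 2) M :=
    IsManifold.of_le (n := ∞) (by simpa using hle)
  have h1 := VectorField.mpullback_mlieBracket (n := ∞) (hX.mdifferentiableAt (by simp))
    (hY.mdifferentiableAt (by simp)) (h.contMDiffAt hp) (by simpa using hle)
  refine h1.trans ?_
  rw [← VectorField.mlieBracketWithin_univ, VectorField.mlieBracketWithin_eq_lieBracketWithin]
  exact congrFun (VectorField.lieBracketWithin_univ (𝕜 := ℝ) (V := liftV π X) (W := liftV π Y)) p

lemma liftV_app {A : C2 → C2 →L[ℝ] C2} (hσ : ∀ x, σ x ∈ U ∧ π (σ x) = x)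
    (hA : EndDescends π U A) (X : VectField M) {p : C2} (hp : p ∈ U) :
    liftV π ((pushEnd π σ A).app X) p = A p (liftV π X p) := by
  have h1 : (pushEnd π σ A).app X (π p) = dcov π p (A p (liftV π X p)) :=
    pushEnd_apply hσ hA hp _
  change (dcov π p).inverse ((pushEnd π σ A).app X (π p)) = _
  rw [h1]
  exact (h.isInvertible hp).inverse_apply_self _

omit h in
lemma SmoothVectAt.app {A : EndField M} (hA : SmoothEnd A) {X : VectField M} {x : M}
    (hX : SmoothVectAt X x) : SmoothVectAt (A.app X) x := by
  have : IsManifold 𝓘(ℝ, C2) 1 M := IsManifold.of_le (n := ∞) (by simp)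
  exact ContMDiffAt.clm_bundle_apply (hA x) hX

/-- Integrability on `M` follows from the vanishing of the Nijenhuis tensor on the covering. -/
lemma integrable_pushEnd (hσ : ∀ x, σ x ∈ U ∧ π (σ x) = x)
    {A : C2 → C2 →L[ℝ] C2} (hA : EndDescends π U A) (hs : ContDiffOn ℝ ∞ A U)
    (hN : ∀ p ∈ U, ∀ u v, flatNijenhuis A p u v = 0) : Integrable (pushEnd π σ A) := by
  intro x X Y hX hY
  obtain ⟨p, hp, rfl⟩ := h.surj x
  have hsm := smoothEnd_pushEnd h hσ hA hs
  set B := pushEnd π σ A with hB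
  have hAX := hX.app hsm
  have hAY := hY.app hsm
  have dA : DifferentiableAt ℝ A p :=
    (hs.contDiffAt (h.isOpen.mem_nhds hp)).differentiableAt (by simp)
  have dX : DifferentiableAt ℝ (liftV π X) p := (contDiffAt_liftV h hp hX).differentiableAt (by simp)
  have dY : DifferentiableAt ℝ (liftV π Y) p := (contDiffAt_liftV h hp hY).differentiableAt (by simp)
  -- The product rule for `A Z`, on the covering.
  have key : ∀ (Z : VectField M), DifferentiableAt ℝ (liftV π Z) p → ∀ w,
      fderiv ℝ (liftV π (B.app Z)) p w =
        fderiv ℝ A p w (liftV π Z p) + A p (fderiv ℝ (liftV π Z) p w) := by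
    intro Z dZ w
    have e : liftV π (B.app Z) =ᶠ[𝓝 p] fun q => A q (liftV π Z q) := by
      filter_upwards [h.isOpen.mem_nhds hp] with q hq using liftV_app h hσ hA Z hq
    rw [e.fderiv_eq, fderiv_clm_apply dA dZ]
    simp [add_comm]
  have e1 : (dcov π p).inverse (nijenhuis B X Y (π p)) = 0 := by
    have a1 : ∀ Z : VectField M, (dcov π p).inverse (B (π p) (Z (π p))) = A p (liftV π Z p) :=
      fun Z => liftV_app h hσ hA Z hp
    have a2 : nijenhuis B X Y (π p) = bracket (B.app X) (B.app Y) (π p)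
      + B (π p) (B.app (bracket X Y) (π p)) - B (π p) (bracket (B.app X) Y (π p))
      - B (π p) (bracket X (B.app Y) (π p)) := rfl
    have b1 := liftV_bracket h hp hAX hAY
    have b2 := liftV_bracket h hp hAX hY
    have b3 := liftV_bracket h hp hX hAY
    have b4 := liftV_bracket h hp hX hY
    have b5 := liftV_app h hσ hA (bracket X Y) hp
    have c : (dcov π p).inverse (nijenhuis B X Y (π p)) =
        liftV π (bracket (B.app X) (B.app Y)) p + A p (liftV π (B.app (bracket X Y)) p)
        - A p (liftV π (bracket (B.app X) Y) p) - A p (liftV π (bracket X (B.app Y)) p) := by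
      have lin : ∀ a b c d : C2, (dcov π p).inverse (a + b - c - d) = (dcov π p).inverse a +
          (dcov π p).inverse b - (dcov π p).inverse c - (dcov π p).inverse d := by
        intro a b c d
        simp only [map_add, map_sub]
      rw [a2, ← a1, ← a1, ← a1]
      exact lin _ _ _ _
    rw [c, b1, b2, b3, b5, b4, key X dX, key Y dY, key X dX, key Y dY, liftV_app h hσ hA X hp,
      liftV_app h hσ hA Y hp, ← hN p hp (liftV π X p) (liftV π Y p), flatNijenhuis]
    simp only [map_add, map_sub]
    abel
  have := (h.isInvertible hp).self_apply_inverse (nijenhuis B X Y (π p))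
  rw [e1, map_zero] at this
  exact this.symm

/-- The derivative of a function along a vector field can be computed on the covering. -/
lemma lieD_eq {p : C2} (hp : p ∈ U) (X : VectField M) {f : M → ℝ}
    (hf : DifferentiableAt ℝ (f ∘ π) p) :
    lieD X f (π p) = fderiv ℝ (f ∘ π) p (liftV π X p) := by
  obtain ⟨ψ, hψ, hψp, hψr, -⟩ := h.exists_section hp
  have h1 : MDifferentiableAt 𝓘(ℝ, C2) 𝓘(ℝ, ℝ) f (π p) := by
    have h2 : MDifferentiableAt 𝓘(ℝ, C2) 𝓘(ℝ, ℝ) (f ∘ π) (ψ (π p)) := by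
      rw [hψp]; exact hf.mdifferentiableAt
    refine (h2.comp (π p) (hψ.mdifferentiableAt (by simp))).congr_of_eventuallyEq ?_
    filter_upwards [hψr] with y hy
    simp [hy.2]
  rw [← mfderiv_eq_fderiv, mfderiv_comp p h1 (h.mdifferentiableAt hp), lieD, ← dcov_liftV h hp X]
  rfl

/-- Every vector of `ℂ²` is, near a given point, the constant lift of a smooth vector field. -/
lemma exists_constant_lift {p : C2} (hp : p ∈ U) (u : C2) :
    ∃ X : VectField M, SmoothVectAt X (π p) ∧ liftV π X =ᶠ[𝓝 p] fun _ => u := by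
  have : IsManifold 𝓘(ℝ, C2) 1 M := IsManifold.of_le (n := ∞) (by simp)
  obtain ⟨ψ, hψ, hψp, hψr, hψl⟩ := h.exists_section hp
  refine ⟨fun y => dcov π (ψ y) u, (Bundle.contMDiffAt_section _).2 ?_, ?_⟩
  · have h1 := contMDiffAt_of_lift h hp (n := 0) (s := 0)
      (f := fun z => trivL (π p) z.2 (dcov π (ψ z.2) u))
      (G := fun z => fderiv ℝ (extChartAt 𝓘(ℝ, C2) (π p) ∘ π) z.2 u)
      ((h.contDiffAt_fderiv_chart hp).snd'.clm_apply contDiffAt_const) (by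
        filter_upwards [h.eventually_source hp rfl, hψl] with q hq hq' t
        rw [← h.triv_comp_dcov hq.1 hq.2, hq']
        rfl)
    have h2 : ContMDiffAt 𝓘(ℝ, C2) (𝓘(ℝ, Fin 0 → ℝ).prod 𝓘(ℝ, C2)) ∞
        (fun y : M => ((0 : Fin 0 → ℝ), y)) (π p) := contMDiffAt_const.prodMk contMDiffAt_id
    refine (ContMDiffAt.comp (π p) h1 h2).congr_of_eventuallyEq ?_
    filter_upwards [(chartAt C2 (π p)).open_source.mem_nhds (mem_chart_source _ _)] with y hy
    exact ((trivializationAt C2 (TangentSpace 𝓘(ℝ, C2)) (π p)).continuousLinearMapAt_apply_of_mem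
      (R := ℝ) (by simpa using hy) _).symm
  · filter_upwards [hψl, h.isOpen.mem_nhds hp] with q hq hqU
    change (dcov π q).inverse (dcov π (ψ (π q)) u) = u
    rw [hq]
    exact (h.isInvertible hqU).inverse_apply_self u

end Lift

/-! ### Descent of para-hyperhermitian structures -/

/-- Multiplication by `i` on `ℂ²`. -/
def mulI : C2 →L[ℝ] C2 := Complex.I • ContinuousLinearMap.id ℝ C2

@[simp] lemma mulI_apply (u : C2) : mulI u = Complex.I • u := rfl

section Descent

variable {M : Type*} [TopologicalSpace M] [ChartedSpace C2 M]

/-- A holomorphic covering `π : U → M`, as far as the smooth category is concerned: a smooth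
covering with complex linear differential. -/
structure IsHolCover (π : C2 → M) (U : Set C2) : Prop extends IsCover π U where
  map_I : ∀ p ∈ U, ∀ u, dcov π p (Complex.I • u) = Complex.I • dcov π p u

/-- A para-hyperhermitian structure `(g, i, S, iS)` on `U ⊆ ℂ²` that descends along `π`. The fields
are defined on all of `ℂ²`, but only their values on `U` matter. -/
structure FlatPHH (π : C2 → M) (U : Set C2) where
  S : C2 → C2 →L[ℝ] C2
  g : C2 → C2 →L[ℝ] C2 →L[ℝ] ℝ
  smooth_S : ContDiffOn ℝ ∞ S U
  smooth_g : ContDiffOn ℝ ∞ g U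
  S_sq : ∀ p ∈ U, ∀ u, S p (S p u) = u
  anticomm : ∀ p ∈ U, ∀ u, S p (Complex.I • u) = -(Complex.I • S p u)
  nijenhuis_S : ∀ p ∈ U, ∀ u v, flatNijenhuis S p u v = 0
  nijenhuis_T : ∀ p ∈ U, ∀ u v, flatNijenhuis (fun p => mulI.comp (S p)) p u v = 0
  symm : ∀ p ∈ U, ∀ u v, g p u v = g p v u
  nondegenerate : ∀ p ∈ U, ∀ u, (∀ v, g p u v = 0) → u = 0
  skew_I : ∀ p ∈ U, ∀ u v, g p (Complex.I • u) v = -g p u (Complex.I • v)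
  skew_S : ∀ p ∈ U, ∀ u v, g p (S p u) v = -g p u (S p v)
  descends_S : EndDescends π U S
  descends_g : BilinDescends π U g

variable {π : C2 → M} {U : Set C2}

lemma IsHolCover.inverse_map_I [IsManifold 𝓘(ℝ, C2) ∞ M] (h : IsHolCover π U) {p : C2}
    (hp : p ∈ U) (u : C2) :
    (dcov π p).inverse (Complex.I • u) = Complex.I • (dcov π p).inverse u := by
  rw [(h.isInvertible hp).inverse_apply_eq, h.map_I p hp, (h.isInvertible hp).self_apply_inverse]

lemma IsHolCover.descends_mulI [IsManifold 𝓘(ℝ, C2) ∞ M] (h : IsHolCover π U) :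
    EndDescends π U (fun _ => mulI) := by
  intro p hp q hq _ u
  rw [mulI_apply, mulI_apply, h.map_I q hq, h.map_I p hp, (h.isInvertible hp).self_apply_inverse,
    (h.isInvertible hq).self_apply_inverse]

lemma EndDescends.mulI_comp [IsManifold 𝓘(ℝ, C2) ∞ M] (h : IsHolCover π U)
    {S : C2 → C2 →L[ℝ] C2} (hS : EndDescends π U S) :
    EndDescends π U (fun p => mulI.comp (S p)) := by
  intro p hp q hq hpq u
  rw [ContinuousLinearMap.comp_apply, ContinuousLinearMap.comp_apply, mulI_apply, mulI_apply,
    h.map_I q hq, h.map_I p hp, hS p hp q hq hpq u]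

variable [IsManifold 𝓘(ℝ, C2) ∞ M] {σ : M → C2}

lemma pushEnd_mulI (h : IsHolCover π U) (hσ : ∀ x, σ x ∈ U ∧ π (σ x) = x) :
    pushEnd π σ (fun _ => mulI) = complexStructure M := by
  funext x
  refine ContinuousLinearMap.ext fun (u : C2) => ?_
  change dcov π (σ x) (Complex.I • (dcov π (σ x)).inverse u) = Complex.I • (u : C2)
  rw [h.map_I _ (hσ x).1, (h.isInvertible (hσ x).1).self_apply_inverse]

/-- The para-hyperhermitian structure on `M` obtained from one on the covering. -/
def FlatPHH.toPHH (F : FlatPHH π U) (h : IsHolCover π U) (hσ : ∀ x, σ x ∈ U ∧ π (σ x) = x) :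
    ParaHyperhermitian M where
  I := complexStructure M
  S := pushEnd π σ F.S
  T := pushEnd π σ (fun p => mulI.comp (F.S p))
  g := pushBilin π σ F.g
  smooth_I := by
    rw [← pushEnd_mulI h hσ]
    exact smoothEnd_pushEnd h.toIsCover hσ h.descends_mulI contDiffOn_const
  smooth_S := smoothEnd_pushEnd h.toIsCover hσ F.descends_S F.smooth_S
  smooth_T := smoothEnd_pushEnd h.toIsCover hσ (F.descends_S.mulI_comp h)
    (contDiffOn_const.clm_comp F.smooth_S)
  I_sq x (u : C2) := by
    change Complex.I • Complex.I • u = -u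
    rw [smul_smul, Complex.I_mul_I, neg_smul, one_smul]
  S_sq x (u : C2) := by
    change dcov π (σ x) (F.S _ ((dcov π (σ x)).inverse
      (dcov π (σ x) (F.S _ ((dcov π (σ x)).inverse u))))) = u
    rw [(h.isInvertible (hσ x).1).inverse_apply_self, F.S_sq _ (hσ x).1,
      (h.isInvertible (hσ x).1).self_apply_inverse]
  T_eq x (u : C2) := h.map_I _ (hσ x).1 _
  anticomm x (u : C2) := by
    change Complex.I • dcov π (σ x) (F.S _ ((dcov π (σ x)).inverse u)) =
      -dcov π (σ x) (F.S _ ((dcov π (σ x)).inverse (Complex.I • u)))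
    rw [h.inverse_map_I (hσ x).1, F.anticomm _ (hσ x).1, map_neg, neg_neg, h.map_I _ (hσ x).1]
  integrable_I := by
    rw [← pushEnd_mulI h hσ]
    refine integrable_pushEnd h.toIsCover hσ h.descends_mulI contDiffOn_const fun p _ u v => ?_
    simp [flatNijenhuis]
  integrable_S := integrable_pushEnd h.toIsCover hσ F.descends_S F.smooth_S F.nijenhuis_S
  integrable_T := integrable_pushEnd h.toIsCover hσ (F.descends_S.mulI_comp h)
    (contDiffOn_const.clm_comp F.smooth_S) F.nijenhuis_T
  smooth_g := smoothBilin_pushBilin h.toIsCover hσ F.descends_g F.smooth_g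
  symm x u v := F.symm _ (hσ x).1 _ _
  nondegenerate x (u : C2) hu := by
    have h1 : (dcov π (σ x)).inverse u = 0 := by
      refine F.nondegenerate _ (hσ x).1 _ fun v => ?_
      have h2 : F.g (σ x) ((dcov π (σ x)).inverse u)
        ((dcov π (σ x)).inverse (dcov π (σ x) v)) = 0 := hu (dcov π (σ x) v)
      rwa [(h.isInvertible (hσ x).1).inverse_apply_self] at h2
    have h2 := (h.isInvertible (hσ x).1).self_apply_inverse u
    rw [h1, map_zero] at h2
    exact h2.symm
  skew_I x (u : C2) (v : C2) := by
    change F.g _ ((dcov π (σ x)).inverse (Complex.I • u)) ((dcov π (σ x)).inverse v) =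
      -F.g _ ((dcov π (σ x)).inverse u) ((dcov π (σ x)).inverse (Complex.I • v))
    rw [h.inverse_map_I (hσ x).1, h.inverse_map_I (hσ x).1, F.skew_I _ (hσ x).1]
  skew_S x (u : C2) (v : C2) := by
    change F.g _ ((dcov π (σ x)).inverse (dcov π (σ x)
        (F.S (σ x) ((dcov π (σ x)).inverse u)))) ((dcov π (σ x)).inverse v) =
      -F.g _ ((dcov π (σ x)).inverse u) ((dcov π (σ x)).inverse (dcov π (σ x)
        (F.S (σ x) ((dcov π (σ x)).inverse v))))
    rw [(h.isInvertible (hσ x).1).inverse_apply_self,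
      (h.isInvertible (hσ x).1).inverse_apply_self, F.skew_S _ (hσ x).1]
  skew_T x (u : C2) (v : C2) := by
    change F.g _ ((dcov π (σ x)).inverse (dcov π (σ x)
        (Complex.I • F.S (σ x) ((dcov π (σ x)).inverse u)))) ((dcov π (σ x)).inverse v) =
      -F.g _ ((dcov π (σ x)).inverse u) ((dcov π (σ x)).inverse (dcov π (σ x)
        (Complex.I • F.S (σ x) ((dcov π (σ x)).inverse v))))
    rw [(h.isInvertible (hσ x).1).inverse_apply_self,
      (h.isInvertible (hσ x).1).inverse_apply_self, F.skew_I _ (hσ x).1,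
      F.skew_S _ (hσ x).1, F.anticomm _ (hσ x).1, map_neg, neg_neg]

variable (F F' : FlatPHH π U) (h : IsHolCover π U) (hσ : ∀ x, σ x ∈ U ∧ π (σ x) = x)

/-- The descended para-hypercomplex structure determines `S` on the covering. -/
lemma FlatPHH.S_eq_of_toPHH_eq
    (he : (F.toPHH h hσ).toParaHypercomplex = (F'.toPHH h hσ).toParaHypercomplex) {p : C2}
    (hp : p ∈ U) : F.S p = F'.S p := by
  have h1 : pushEnd π σ F.S = pushEnd π σ F'.S := congrArg ParaHypercomplex.S he
  refine ContinuousLinearMap.ext fun u => ?_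
  have h2 := pushEnd_apply hσ F.descends_S hp (dcov π p u)
  have h3 := pushEnd_apply hσ F'.descends_S hp (dcov π p u)
  rw [(h.isInvertible hp).inverse_apply_self] at h2 h3
  rw [h1] at h2
  have h4 := congrArg (dcov π p).inverse (h2.symm.trans h3)
  rwa [(h.isInvertible hp).inverse_apply_self, (h.isInvertible hp).inverse_apply_self] at h4

/-- The descended structure determines the metric on the covering. -/
lemma FlatPHH.g_eq_of_toPHH_eq (he : F.toPHH h hσ = F'.toPHH h hσ) {p : C2}
    (hp : p ∈ U) (u v : C2) : F.g p u v = F'.g p u v := by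
  have h1 : pushBilin π σ F.g = pushBilin π σ F'.g := congrArg ParaHyperhermitian.g he
  have h2 := pushBilin_apply hσ F.descends_g hp (dcov π p u) (dcov π p v)
  have h3 := pushBilin_apply hσ F'.descends_g hp (dcov π p u) (dcov π p v)
  rw [(h.isInvertible hp).inverse_apply_self, (h.isInvertible hp).inverse_apply_self] at h2 h3
  rw [h1] at h2
  exact h2.symm.trans h3

/-- A family of structures that is smooth on the covering descends to a smooth family. -/
lemma FlatPHH.isSmoothFamily {V : Type} [AddCommGroup V] [Module ℝ V] (F : V → FlatPHH π U)
    (hS : ∀ (n : ℕ) (L : (Fin n → ℝ) →ₗ[ℝ] V),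
      ContDiffOn ℝ ∞ (fun z : (Fin n → ℝ) × C2 => (F (L z.1)).S z.2) (univ ×ˢ U))
    (hg : ∀ (n : ℕ) (L : (Fin n → ℝ) →ₗ[ℝ] V),
      ContDiffOn ℝ ∞ (fun z : (Fin n → ℝ) × C2 => (F (L z.1)).g z.2) (univ ×ˢ U)) :
    IsSmoothFamily (fun v => (F v).toPHH h hσ) := by
  intro n L
  refine ⟨?_, smoothEndFamily_pushEnd h.toIsCover hσ (fun s => (F (L s)).descends_S) (hS n L),
    smoothEndFamily_pushEnd h.toIsCover hσ (fun s => (F (L s)).descends_S.mulI_comp h)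
      (contDiffOn_const.clm_comp (hS n L)),
    smoothBilinFamily_pushBilin h.toIsCover hσ (fun s => (F (L s)).descends_g) (hg n L)⟩
  have h1 := smoothEndFamily_pushEnd h.toIsCover hσ (n := n) (A := fun _ _ => mulI)
    (fun _ => h.descends_mulI) contDiffOn_const
  rw [pushEnd_mulI h hσ] at h1
  exact h1

end Descent

/-! ### Linear algebra and integrability of the model -/

/-- The endomorphism `(a, b) ↦ (P ā, Q ā + R b̄)` of `ℂ²`. -/
def modelS (P Q R : ℂ) : C2 →L[ℝ] C2 :=
  (P • (Complex.conjCLE.toContinuousLinearMap.comp (ContinuousLinearMap.fst ℝ ℂ ℂ))).prod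
    (Q • (Complex.conjCLE.toContinuousLinearMap.comp (ContinuousLinearMap.fst ℝ ℂ ℂ)) +
      R • (Complex.conjCLE.toContinuousLinearMap.comp (ContinuousLinearMap.snd ℝ ℂ ℂ)))

lemma modelS_apply (P Q R : ℂ) (u : C2) : modelS P Q R u =
    (P * (starRingEnd ℂ) u.1, Q * (starRingEnd ℂ) u.1 + R * (starRingEnd ℂ) u.2) := by
  simp [modelS]

/-- The symmetric form `φ Re (a ā') + Re (k (ā b' + b ā'))` on `ℂ²`. -/
def modelG (φ : ℝ) (k : ℂ) : C2 →L[ℝ] C2 →L[ℝ] ℝ :=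
  (ContinuousLinearMap.compL ℝ C2 ℂ ℝ Complex.reCLM).comp
    ((φ : ℂ) • (ContinuousLinearMap.mul ℝ ℂ).bilinearComp (ContinuousLinearMap.fst ℝ ℂ ℂ)
        (Complex.conjCLE.toContinuousLinearMap.comp (ContinuousLinearMap.fst ℝ ℂ ℂ)) +
      k • ((ContinuousLinearMap.mul ℝ ℂ).bilinearComp
          (Complex.conjCLE.toContinuousLinearMap.comp (ContinuousLinearMap.fst ℝ ℂ ℂ))
          (ContinuousLinearMap.snd ℝ ℂ ℂ) +
        (ContinuousLinearMap.mul ℝ ℂ).bilinearComp (ContinuousLinearMap.snd ℝ ℂ ℂ)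
          (Complex.conjCLE.toContinuousLinearMap.comp (ContinuousLinearMap.fst ℝ ℂ ℂ))))

lemma modelG_apply (φ : ℝ) (k : ℂ) (u v : C2) : modelG φ k u v =
    (φ * (u.1 * (starRingEnd ℂ) v.1) +
      k * ((starRingEnd ℂ) u.1 * v.2 + u.2 * (starRingEnd ℂ) v.1)).re := by
  simp [modelG, mul_add]

lemma contDiffOn_modelS {F : Type*} [NormedAddCommGroup F] [NormedSpace ℝ F] {s : Set F}
    {P Q : F → ℂ} {R : ℂ} (hP : ContDiffOn ℝ ∞ P s) (hQ : ContDiffOn ℝ ∞ Q s) :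
    ContDiffOn ℝ ∞ (fun z => modelS (P z) (Q z) R) s := by
  rw [contDiffOn_clm_apply]
  intro u
  simp only [modelS_apply]
  fun_prop

lemma contDiffOn_modelG {F : Type*} [NormedAddCommGroup F] [NormedSpace ℝ F] {s : Set F}
    {c φ : F → ℝ} {k : F → ℂ} (hc : ContDiffOn ℝ ∞ c s) (hφ : ContDiffOn ℝ ∞ φ s)
    (hk : ContDiffOn ℝ ∞ k s) :
    ContDiffOn ℝ ∞ (fun z => c z • modelG (φ z) (k z)) s := by
  rw [contDiffOn_clm_apply]
  intro u
  rw [contDiffOn_clm_apply]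
  intro v
  have h1 : ContDiffOn ℝ ∞ (fun z => ((φ z : ℝ) : ℂ)) s :=
    Complex.ofRealCLM.contDiff.comp_contDiffOn hφ
  have h2 : ContDiffOn ℝ ∞ (fun z => ((φ z : ℂ) * (u.1 * (starRingEnd ℂ) v.1) +
      k z * ((starRingEnd ℂ) u.1 * v.2 + u.2 * (starRingEnd ℂ) v.1))) s := by fun_prop
  have h3 := Complex.reCLM.contDiff.comp_contDiffOn h2
  refine (hc.mul h3).congr fun z _ => ?_
  rw [smul_apply, smul_apply, modelG_apply]
  rfl

/-- Wirtinger decomposition of a real linear map `ℂ → ℂ`. -/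
lemma exists_wirtinger (L : ℂ →L[ℝ] ℂ) :
    ∃ α β : ℂ, ∀ w, L w = α * w + β * (starRingEnd ℂ) w := by
  refine ⟨(L 1 - Complex.I * L Complex.I) / 2, (L 1 + Complex.I * L Complex.I) / 2, fun w => ?_⟩
  have h1 : w = w.re • (1 : ℂ) + w.im • Complex.I := by apply Complex.ext <;> simp
  have h2 : L w = w.re * L 1 + w.im * L Complex.I := by
    conv_lhs => rw [h1, map_add, map_smul, map_smul]
    simp
  rw [h2, Complex.re_eq_add_conj, Complex.im_eq_sub_conj]
  field_simp
  linear_combination (w - (starRingEnd ℂ) w) * L Complex.I * Complex.I_sq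

/-- Integrability of the model: the Nijenhuis tensor is a multiple of the antiholomorphic
derivative of the identity `S² = 1`. -/
lemma flatNijenhuis_modelS {P Q : ℂ → ℂ} {R : ℂ} {W : Set ℂ} (hW : IsOpen W)
    (hP : ContDiffOn ℝ ∞ P W) (hQ : ContDiffOn ℝ ∞ Q W)
    (h1 : ∀ z ∈ W, P z * (starRingEnd ℂ) (P z) = 1)
    (h2 : ∀ z ∈ W, Q z * (starRingEnd ℂ) (P z) + R * (starRingEnd ℂ) (Q z) = 0)
    {p : C2} (hp : p.1 ∈ W) (u v : C2) :
    flatNijenhuis (fun p => modelS (P p.1) (Q p.1) R) p u v = 0 := by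
  have dP := ((hP.contDiffAt (hW.mem_nhds hp)).differentiableAt (by simp)).hasFDerivAt
  have dQ := ((hQ.contDiffAt (hW.mem_nhds hp)).differentiableAt (by simp)).hasFDerivAt
  have dA : DifferentiableAt ℝ (fun p : C2 => modelS (P p.1) (Q p.1) R) p := by
    have h3 : ContDiffOn ℝ ∞ (fun p : C2 => modelS (P p.1) (Q p.1) R) (Prod.fst ⁻¹' W) :=
      contDiffOn_modelS (hP.comp contDiffOn_fst fun _ h => h)
        (hQ.comp contDiffOn_fst fun _ h => h)
    exact (h3.contDiffAt ((hW.preimage continuous_fst).mem_nhds hp)).differentiableAt (by simp)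
  obtain ⟨α, β, hP'⟩ := exists_wirtinger (fderiv ℝ P p.1)
  obtain ⟨γ, δ, hQ'⟩ := exists_wirtinger (fderiv ℝ Q p.1)
  have key : ∀ w y : C2, fderiv ℝ (fun p : C2 => modelS (P p.1) (Q p.1) R) p w y =
      (fderiv ℝ P p.1 w.1 * (starRingEnd ℂ) y.1, fderiv ℝ Q p.1 w.1 * (starRingEnd ℂ) y.1) := by
    intro w y
    have e0 := (dA.hasFDerivAt.clm_apply (hasFDerivAt_const y p))
    have e1 : HasFDerivAt (fun p : C2 => modelS (P p.1) (Q p.1) R y) _ p :=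
      HasFDerivAt.congr_of_eventuallyEq
        (((dP.comp p hasFDerivAt_fst).mul_const ((starRingEnd ℂ) y.1)).prodMk
          (((dQ.comp p hasFDerivAt_fst).mul_const ((starRingEnd ℂ) y.1)).add_const
            (R * (starRingEnd ℂ) y.2)))
        (Eventually.of_forall fun p => modelS_apply _ _ _ _)
    have e2 := congrArg (fun L : C2 →L[ℝ] C2 => L w) (e0.unique e1)
    simpa [mul_comm] using e2
  -- The derivatives of the two components of the identity `S² = 1`.
  have c1 : ∀ w, fderiv ℝ P p.1 w * (starRingEnd ℂ) (P p.1) +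
      P p.1 * (starRingEnd ℂ) (fderiv ℝ P p.1 w) = 0 := by
    intro w
    have e0 := dP.mul (Complex.conjCLE.toContinuousLinearMap.hasFDerivAt.comp p.1 dP)
    have e1 : HasFDerivAt (fun z => P z * (starRingEnd ℂ) (P z)) (0 : ℂ →L[ℝ] ℂ) p.1 :=
      (hasFDerivAt_const (1 : ℂ) p.1).congr_of_eventuallyEq
        ((hW.eventually_mem hp).mono fun z hz => h1 z hz)
    have e2 := congrArg (fun L : ℂ →L[ℝ] ℂ => L w) (e0.unique e1)
    simpa [mul_comm, add_comm] using e2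
  have c2 : ∀ w, fderiv ℝ Q p.1 w * (starRingEnd ℂ) (P p.1) +
      Q p.1 * (starRingEnd ℂ) (fderiv ℝ P p.1 w) + R * (starRingEnd ℂ) (fderiv ℝ Q p.1 w) = 0 := by
    intro w
    have e0 := (dQ.mul (Complex.conjCLE.toContinuousLinearMap.hasFDerivAt.comp p.1 dP)).add
      ((Complex.conjCLE.toContinuousLinearMap.hasFDerivAt.comp p.1 dQ).const_mul R)
    have e1 : HasFDerivAt (fun z => Q z * (starRingEnd ℂ) (P z) + R * (starRingEnd ℂ) (Q z))
        (0 : ℂ →L[ℝ] ℂ) p.1 :=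
      (hasFDerivAt_const (0 : ℂ) p.1).congr_of_eventuallyEq
        ((hW.eventually_mem hp).mono fun z hz => h2 z hz)
    have e2 := congrArg (fun L : ℂ →L[ℝ] ℂ => L w) (e0.unique e1)
    simpa [mul_comm, add_comm, add_left_comm] using e2
  -- Their antiholomorphic parts.
  have d1 : β * (starRingEnd ℂ) (P p.1) + P p.1 * (starRingEnd ℂ) α = 0 := by
    have a1 := c1 1
    have a2 := c1 Complex.I
    rw [hP'] at a1 a2
    simp only [map_one, map_add, map_mul, map_neg, Complex.conj_I] at a1 a2
    linear_combination a1 / 2 + Complex.I * a2 / 2 +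
      (-α * (starRingEnd ℂ) (P p.1) + β * (starRingEnd ℂ) (P p.1)
        + P p.1 * (starRingEnd ℂ) α - P p.1 * (starRingEnd ℂ) β) * Complex.I_sq / 2
  have d2 : δ * (starRingEnd ℂ) (P p.1) + Q p.1 * (starRingEnd ℂ) α + R * (starRingEnd ℂ) γ = 0 := by
    have a1 := c2 1
    have a2 := c2 Complex.I
    rw [hP', hQ'] at a1 a2
    simp only [map_one, map_add, map_mul, map_neg, Complex.conj_I] at a1 a2
    linear_combination a1 / 2 + Complex.I * a2 / 2 +
      (-γ * (starRingEnd ℂ) (P p.1) + δ * (starRingEnd ℂ) (P p.1)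
        + Q p.1 * (starRingEnd ℂ) α - Q p.1 * (starRingEnd ℂ) β
        + R * (starRingEnd ℂ) γ - R * (starRingEnd ℂ) δ) * Complex.I_sq / 2
  rw [flatNijenhuis, key, key, key, key]
  simp only [modelS_apply, hP', hQ', map_mul, map_add, Complex.conj_conj]
  refine Prod.ext ?_ ?_
  · simp only [Prod.fst_sub, Prod.fst_add, Prod.fst_zero]
    linear_combination (u.1 * (starRingEnd ℂ) v.1 - v.1 * (starRingEnd ℂ) u.1) * d1
  · simp only [Prod.snd_sub, Prod.snd_add, Prod.snd_zero]
    linear_combination (u.1 * (starRingEnd ℂ) v.1 - v.1 * (starRingEnd ℂ) u.1) * d2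

/-! ### Deck transformations -/

section Deck

/-- `g` is an affine automorphism of `U ⊆ ℂ²` preserving the endomorphism field `S` and the field
`G` of bilinear forms. -/
def IsAffineSymm (U : Set C2) (S : C2 → C2 →L[ℝ] C2) (G : C2 → C2 →L[ℝ] C2 →L[ℝ] ℝ)
    (g : Equiv.Perm C2) : Prop :=
  (∀ p, p ∈ U ↔ g p ∈ U) ∧ ∃ (L : C2 →L[ℝ] C2) (b : C2), (∀ p, g p = L p + b) ∧
    ∀ p ∈ U, (∀ u, S (g p) (L u) = L (S p u)) ∧ ∀ u v, G (g p) (L u) (L v) = G p u v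

variable {U : Set C2} {S : C2 → C2 →L[ℝ] C2} {G : C2 → C2 →L[ℝ] C2 →L[ℝ] ℝ}

lemma IsAffineSymm.one : IsAffineSymm U S G 1 :=
  ⟨fun _ => Iff.rfl, ContinuousLinearMap.id ℝ C2, 0, fun p => by simp, fun p _ => by simp⟩

lemma IsAffineSymm.mul {g g' : Equiv.Perm C2} (h : IsAffineSymm U S G g)
    (h' : IsAffineSymm U S G g') : IsAffineSymm U S G (g * g') := by
  obtain ⟨hU, L, b, hL, hS⟩ := h
  obtain ⟨hU', L', b', hL', hS'⟩ := h'
  refine ⟨fun p => (hU' p).trans (hU _), L.comp L', L b' + b, fun p => ?_, fun p hp => ?_⟩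
  · rw [Equiv.Perm.mul_apply, hL, hL', map_add, ContinuousLinearMap.comp_apply, add_assoc]
  · have h1 := hS' p hp
    have h2 := hS (g' p) ((hU' p).1 hp)
    refine ⟨fun u => ?_, fun u v => ?_⟩
    · simp only [Equiv.Perm.mul_apply, ContinuousLinearMap.comp_apply]
      rw [h2.1, h1.1]
    · simp only [Equiv.Perm.mul_apply, ContinuousLinearMap.comp_apply]
      rw [h2.2, h1.2]

lemma IsAffineSymm.inv {g : Equiv.Perm C2} (h : IsAffineSymm U S G g) :
    IsAffineSymm U S G g⁻¹ := by
  obtain ⟨hU, L, b, hL, hS⟩ := h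
  have hbij : Function.Bijective L := by
    have : (L : C2 → C2) = fun p => g p - b := by
      funext p
      rw [hL p, add_sub_cancel_right]
    rw [this]
    exact (Equiv.subRight b).bijective.comp g.bijective
  let e : C2 ≃L[ℝ] C2 := (LinearEquiv.ofBijective (L : C2 →ₗ[ℝ] C2) hbij).toContinuousLinearEquiv
  have he : ∀ u, L (e.symm u) = u := fun u => e.apply_symm_apply u
  have hgi : ∀ p, g (g⁻¹ p) = p := fun p => g.apply_symm_apply p
  refine ⟨fun p => ?_, e.symm, -e.symm b, fun p => ?_, fun p hp => ?_⟩
  · rw [hU (g⁻¹ p), hgi]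
  · apply g.injective
    rw [hgi, hL, map_add, map_neg]
    change p = L (e.symm p) + -L (e.symm b) + b
    rw [he, he, neg_add_cancel_right]
  · have h1 := hS (g⁻¹ p) ((hU _).2 (by rwa [hgi]))
    rw [hgi] at h1
    refine ⟨fun u => ?_, fun u v => ?_⟩
    · apply hbij.1
      change L _ = L (e.symm _)
      rw [he, ← h1.1]
      change S p (L (e.symm u)) = _
      rw [he]
    · rw [← h1.2]
      change G p (L (e.symm u)) (L (e.symm v)) = _
      rw [he, he]

lemma IsAffineSymm.of_mem_closure {s : Set (Equiv.Perm C2)} (hs : ∀ g ∈ s, IsAffineSymm U S G g)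
    {g : Equiv.Perm C2} (hg : g ∈ Subgroup.closure s) : IsAffineSymm U S G g := by
  induction hg using Subgroup.closure_induction with
  | mem x hx => exact hs x hx
  | one => exact .one
  | mul x y _ _ hx hy => exact hx.mul hy
  | inv x _ hx => exact hx.inv

variable {M : Type*} [TopologicalSpace M] [ChartedSpace C2 M]

/-- `π : U → M` is a holomorphic covering whose fibres are the orbits of the group generated by `s`. -/
structure IsQuotientCover (π : C2 → M) (U : Set C2) (s : Set (Equiv.Perm C2)) : Prop
    extends IsHolCover π U where
  fibre : ∀ p ∈ U, ∀ q ∈ U, π p = π q ↔ ∃ g ∈ Subgroup.closure s, g p = q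

lemma IsQuotient.exists_cover {U : Set C2} {s : Set (Equiv.Perm C2)} (hU : IsOpen U)
    (h : IsQuotient M U (Subgroup.closure s)) : ∃ π : C2 → M, IsQuotientCover π U s := by
  obtain ⟨π, h1, h2, h3⟩ := h
  refine ⟨π, ⟨⟨hU, fun p hp => isLocalDiffeomorphAt_real (h1 ⟨p, hp⟩), fun x => ?_⟩,
    fun p hp => dcov_complex_linear ((h1 ⟨p, hp⟩).mdifferentiableAt (by simp))⟩, h3⟩
  have : x ∈ π '' U := h2 ▸ mem_univ x
  exact this

variable {π : C2 → M} {s : Set (Equiv.Perm C2)}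

/-- Two points over the same point of `M` are related by a deck transformation, whose linear part
`L` intertwines the differentials of `π` and preserves `S` and `G`. -/
lemma IsQuotientCover.exists_linear_deck [IsManifold 𝓘(ℝ, C2) ∞ M] (h : IsQuotientCover π U s)
    (hs : ∀ g ∈ s, IsAffineSymm U S G g) {p q : C2} (hp : p ∈ U) (hq : q ∈ U) (hpq : π p = π q) :
    ∃ L : C2 →L[ℝ] C2, (∀ u, dcov π q (L u) = dcov π p u) ∧
      (∀ u, (dcov π q).inverse u = L ((dcov π p).inverse u)) ∧
      (∀ u, S q (L u) = L (S p u)) ∧ ∀ u v, G q (L u) (L v) = G p u v := by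
  obtain ⟨g, hg, rfl⟩ := (h.fibre p hp q hq).1 hpq
  obtain ⟨hU, L, b, hL, hS⟩ := IsAffineSymm.of_mem_closure hs hg
  have h1 : π ∘ g =ᶠ[𝓝 p] π := by
    filter_upwards [h.isOpen.mem_nhds hp] with x hx
    exact ((h.fibre x hx (g x) ((hU x).1 hx)).2 ⟨g, hg, rfl⟩).symm
  have h2 : HasFDerivAt g L p := by
    have : (g : C2 → C2) = fun p => L p + b := funext hL
    rw [this]
    exact L.hasFDerivAt.add_const b
  have h3 : ∀ u, dcov π (g p) (L u) = dcov π p u := by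
    have h4 := (h.mdifferentiableAt hq).hasMFDerivAt.comp p h2.hasMFDerivAt
    have h5 := h4.congr_of_eventuallyEq h1.symm
    have h6 := h5.mfderiv
    intro u
    rw [dcov, dcov, h6]
    rfl
  refine ⟨L, h3, fun u => ?_, hS p hp⟩
  rw [(h.isInvertible hq).inverse_apply_eq, h3, (h.isInvertible hp).self_apply_inverse]

lemma IsQuotientCover.endDescends [IsManifold 𝓘(ℝ, C2) ∞ M] (h : IsQuotientCover π U s)
    (hs : ∀ g ∈ s, IsAffineSymm U S G g) : EndDescends π U S := by
  intro p hp q hq hpq u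
  obtain ⟨L, h1, h2, h3, -⟩ := h.exists_linear_deck hs hp hq hpq
  rw [h2, h3, h1]

lemma IsQuotientCover.bilinDescends [IsManifold 𝓘(ℝ, C2) ∞ M] (h : IsQuotientCover π U s)
    (hs : ∀ g ∈ s, IsAffineSymm U S G g) : BilinDescends π U G := by
  intro p hp q hq hpq u v
  obtain ⟨L, h1, h2, -, h4⟩ := h.exists_linear_deck hs hp hq hpq
  rw [h2, h2, h4]

/-- A complex linear change of coordinates on the covering conjugates the generators of the deck
group. -/
lemma IsQuotient.conj {s : Set (Equiv.Perm C2)} (e : C2 ≃L[ℂ] C2)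
    (h : IsQuotient M U (Subgroup.closure s)) :
    IsQuotient M (e '' U)
      (Subgroup.closure ((fun g => (e.symm.toEquiv.trans g).trans e.toEquiv) '' s)) := by
  obtain ⟨π, h1, h2, h3⟩ := h
  have hmap : Subgroup.closure ((fun g => (e.symm.toEquiv.trans g).trans e.toEquiv) '' s) =
      (Subgroup.closure s).map e.toEquiv.permCongrHom.toMonoidHom := by
    rw [MonoidHom.map_closure]
    rfl
  refine ⟨π ∘ e.symm, ?_, ?_, ?_⟩
  · rintro ⟨_, p, hp, rfl⟩
    let E : Diffeomorph 𝓘(ℂ, C2) 𝓘(ℂ, C2) C2 C2 ω :=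
      ⟨e.symm.toEquiv, e.symm.contDiff.contMDiff, e.contDiff.contMDiff⟩
    have h4 : IsLocalDiffeomorphAt 𝓘(ℂ, C2) 𝓘(ℂ, C2) ω E (e p) := E.isLocalDiffeomorph _
    have h5 : IsLocalDiffeomorphAt 𝓘(ℂ, C2) 𝓘(ℂ, C2) ω π (E (e p)) := by
      have h6 : E (e p) = p := e.symm_apply_apply p
      rw [h6]
      exact h1 ⟨p, hp⟩
    exact IsLocalDiffeomorphAt.comp (hf := h4) (hg := h5)
  · rw [← h2, image_comp, ← image_comp e.symm e]
    simp
  · rintro _ ⟨p, hp, rfl⟩ _ ⟨q, hq, rfl⟩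
    simp only [Function.comp_apply, e.symm_apply_apply]
    rw [h3 p hp q hq, hmap]
    constructor
    · rintro ⟨g, hg, rfl⟩
      exact ⟨_, Subgroup.mem_map_of_mem _ hg, by simp⟩
    · rintro ⟨_, ⟨g, hg, rfl⟩, hgq⟩
      exact ⟨g, hg, by simpa using hgq⟩

end Deck

/-! ### The model structures on the covering -/

/-- The model endomorphism field `(a, b) ↦ (q² ā, i φ q ā + b̄)`, with `q` and `φ` functions of the
first coordinate. -/
def fieldS (q : ℂ → ℂ) (φ : ℂ → ℝ) (p : C2) : C2 →L[ℝ] C2 :=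
  modelS (q p.1 ^ 2) (Complex.I * φ p.1 * q p.1) 1

/-- The model metric, with quadratic form `c (φ |a|² + 2 Re (i q ā b))`. -/
def fieldG (q : ℂ → ℂ) (φ : ℂ → ℝ) (c : C2 → ℝ) (p : C2) : C2 →L[ℝ] C2 →L[ℝ] ℝ :=
  c p • modelG (φ p.1) (Complex.I * q p.1)

lemma fieldS_apply (q : ℂ → ℂ) (φ : ℂ → ℝ) (p u : C2) : fieldS q φ p u =
    (q p.1 ^ 2 * (starRingEnd ℂ) u.1,
      Complex.I * φ p.1 * q p.1 * (starRingEnd ℂ) u.1 + (starRingEnd ℂ) u.2) := by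
  rw [fieldS, modelS_apply, one_mul]

lemma fieldG_apply (q : ℂ → ℂ) (φ : ℂ → ℝ) (c : C2 → ℝ) (p u v : C2) : fieldG q φ c p u v =
    c p * (φ p.1 * (u.1 * (starRingEnd ℂ) v.1) + Complex.I * q p.1 *
      ((starRingEnd ℂ) u.1 * v.2 + u.2 * (starRingEnd ℂ) v.1)).re := by
  rw [fieldG, smul_apply, smul_apply, modelG_apply, smul_eq_mul]

section Algebra

variable {q : ℂ → ℂ} {φ : ℂ → ℝ} {c : C2 → ℝ}

lemma fieldS_sq {p : C2} (hq : q p.1 * (starRingEnd ℂ) (q p.1) = 1) (u : C2) :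
    fieldS q φ p (fieldS q φ p u) = u := by
  simp only [fieldS_apply, map_mul, map_add, map_pow, Complex.conj_conj, Complex.conj_I,
    Complex.conj_ofReal]
  refine Prod.ext ?_ ?_
  · simp only
    linear_combination (q p.1 * (starRingEnd ℂ) (q p.1) + 1) * u.1 * hq
  · simp only
    linear_combination (Complex.I * φ p.1 * (starRingEnd ℂ) (q p.1)) * u.1 * hq

lemma fieldS_I (p u : C2) :
    fieldS q φ p (Complex.I • u) = -(Complex.I • fieldS q φ p u) := by
  simp only [fieldS_apply, Prod.smul_fst, Prod.smul_snd, smul_eq_mul, map_mul, Complex.conj_I]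
  refine Prod.ext ?_ ?_
  · simp only [Prod.fst_neg, Prod.smul_fst, smul_eq_mul]
    ring
  · simp only [Prod.snd_neg, Prod.smul_snd, smul_eq_mul]
    ring

lemma fieldG_symm (p u v : C2) : fieldG q φ c p u v = fieldG q φ c p v u := by
  rw [fieldG_apply, fieldG_apply]
  congr 1
  simp
  ring

lemma fieldG_I (p u v : C2) :
    fieldG q φ c p (Complex.I • u) v = -fieldG q φ c p u (Complex.I • v) := by
  rw [fieldG_apply, fieldG_apply]
  simp
  ring

/-- The fundamental `2`-form `g(S·, ·)` of the model is `c Re (i q̄ dz ∧ dw)`; in particular it does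
not involve `φ`. -/
lemma fieldG_fieldS {p : C2} (hq : q p.1 * (starRingEnd ℂ) (q p.1) = 1) (u v : C2) :
    fieldG q φ c p (fieldS q φ p u) v =
      c p * (Complex.I * (starRingEnd ℂ) (q p.1) * (u.1 * v.2 - u.2 * v.1)).re := by
  rw [fieldG_apply, fieldS_apply]
  congr 1
  have h1 : (φ p.1 : ℂ) * (q p.1 ^ 2 * (starRingEnd ℂ) u.1 * (starRingEnd ℂ) v.1) +
      Complex.I * q p.1 * ((starRingEnd ℂ) (q p.1 ^ 2 * (starRingEnd ℂ) u.1) * v.2 +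
        (Complex.I * φ p.1 * q p.1 * (starRingEnd ℂ) u.1 + (starRingEnd ℂ) u.2) *
          (starRingEnd ℂ) v.1) = Complex.I * (starRingEnd ℂ) (q p.1) * (u.1 * v.2) -
      (starRingEnd ℂ) (Complex.I * (starRingEnd ℂ) (q p.1) * (u.2 * v.1)) := by
    simp only [map_mul, map_pow, Complex.conj_conj, Complex.conj_I]
    linear_combination (Complex.I * (starRingEnd ℂ) (q p.1) * u.1 * v.2) * hq +
      (φ p.1 * q p.1 ^ 2 * (starRingEnd ℂ) u.1 * (starRingEnd ℂ) v.1) * Complex.I_sq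
  rw [h1, Complex.sub_re, Complex.conj_re, ← Complex.sub_re, ← mul_sub]

lemma fieldG_skew_S {p : C2} (hq : q p.1 * (starRingEnd ℂ) (q p.1) = 1) (u v : C2) :
    fieldG q φ c p (fieldS q φ p u) v = -fieldG q φ c p u (fieldS q φ p v) := by
  rw [fieldG_symm p u, fieldG_fieldS hq, fieldG_fieldS hq, ← mul_neg, ← Complex.neg_re]
  ring_nf

lemma fieldG_nondegenerate {p : C2} (hq : q p.1 * (starRingEnd ℂ) (q p.1) = 1) (hc : c p ≠ 0)
    (u : C2) (hu : ∀ v, fieldG q φ c p u v = 0) : u = 0 := by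
  have h1 : ∀ v : C2, (Complex.I * (starRingEnd ℂ) (q p.1) *
      ((fieldS q φ p u).1 * v.2 - (fieldS q φ p u).2 * v.1)).re = 0 := by
    intro v
    have h2 := fieldG_fieldS (φ := φ) (c := c) hq (fieldS q φ p u) v
    rw [fieldS_sq hq, hu] at h2
    exact (mul_eq_zero.1 h2.symm).resolve_left hc
  have hq0 : Complex.I * (starRingEnd ℂ) (q p.1) ≠ 0 :=
    mul_ne_zero Complex.I_ne_zero (right_ne_zero_of_mul_eq_one hq)
  -- The real part of the product of a nonzero complex number with a variable one is not always zero.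
  have hz : ∀ a : ℂ, (∀ z : ℂ, (Complex.I * (starRingEnd ℂ) (q p.1) * (a * z)).re = 0) → a = 0 := by
    intro a ha
    have h3 := ha ((starRingEnd ℂ) (Complex.I * (starRingEnd ℂ) (q p.1) * a))
    rw [← mul_assoc, Complex.mul_conj, Complex.ofReal_re, Complex.normSq_eq_zero] at h3
    exact (mul_eq_zero.1 h3).resolve_left hq0
  have h4 : fieldS q φ p u = 0 := by
    refine Prod.ext (hz _ fun z => ?_) (hz _ fun z => ?_)
    · simpa using h1 (0, z)
    · have := h1 (-z, 0)
      simpa using this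
  rw [← fieldS_sq (φ := φ) hq u, h4, map_zero]

end Algebra

section Symm

variable {U : Set C2} {q : ℂ → ℂ} {φ : ℂ → ℝ} {c : C2 → ℝ}

/-- Conditions under which the affine map `(z, w) ↦ (l z + a, w + μ z + b)` preserves the model. -/
lemma isAffineSymm_triangular {g : Equiv.Perm C2} (hU : ∀ p, p ∈ U ↔ g p ∈ U) (l : ℝ) (μ a b : ℂ)
    (hg : ∀ z w : ℂ, g (z, w) = (l * z + a, w + μ * z + b))
    (hq : ∀ p ∈ U, q (g p).1 = q p.1) (hq1 : ∀ p ∈ U, q p.1 * (starRingEnd ℂ) (q p.1) = 1)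
    (hφ : ∀ p ∈ U, l * φ (g p).1 = φ p.1 + 2 * (μ * q p.1).im)
    (hc : ∀ p ∈ U, c (g p) * l = c p) :
    IsAffineSymm U (fieldS q φ) (fieldG q φ c) g := by
  refine ⟨hU, (l • ContinuousLinearMap.fst ℝ ℂ ℂ).prod (ContinuousLinearMap.snd ℝ ℂ ℂ +
    μ • ContinuousLinearMap.fst ℝ ℂ ℂ), (a, b), fun p => ?_, fun p hp => ⟨fun u => ?_, fun u v => ?_⟩⟩
  · refine (hg p.1 p.2).trans ?_
    simp
  · simp only [fieldS_apply, hq p hp]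
    have h1 := hφ p hp
    refine Prod.ext ?_ ?_
    · simp
      ring
    · have h2 : (l : ℂ) * φ (g p).1 =
          φ p.1 + -Complex.I * (μ * q p.1 - (starRingEnd ℂ) (μ * q p.1)) := by
        rw [Complex.sub_conj, Complex.ofReal_mul, Complex.ofReal_ofNat]
        have := congrArg (fun x : ℝ => (x : ℂ)) h1
        push_cast at this
        linear_combination this + 2 * ((μ * q p.1).im : ℂ) * Complex.I_sq
      rw [map_mul] at h2
      simp
      linear_combination (Complex.I * q p.1 * (starRingEnd ℂ) u.1) * h2 -
        ((starRingEnd ℂ) u.1 * (starRingEnd ℂ) μ) * hq1 p hp +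
        (q p.1 * (starRingEnd ℂ) u.1 * ((starRingEnd ℂ) μ * (starRingEnd ℂ) (q p.1)
          - μ * q p.1)) * Complex.I_sq
  · simp only [fieldG_apply, hq p hp]
    have h1 := hφ p hp
    rw [Complex.mul_im] at h1
    rw [← hc p hp, mul_assoc (c (g p)) l]
    refine congrArg (c (g p) * ·) ?_
    simp
    linear_combination (l * (u.1.re * v.1.re + u.1.im * v.1.im)) * h1

/-- A real linear map preserves the model with `q = 1`, `φ = 0` as soon as `c` compensates its
determinant. -/
lemma isAffineSymm_real {g : Equiv.Perm C2} (hU : ∀ p, p ∈ U ↔ g p ∈ U) (m₁ m₂ m₃ m₄ : ℝ)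
    (hg : ∀ z w : ℂ, g (z, w) = (m₁ * z + m₂ * w, m₃ * z + m₄ * w))
    (hc : ∀ p ∈ U, c (g p) * (m₁ * m₄ - m₂ * m₃) = c p) :
    IsAffineSymm U (fieldS 1 0) (fieldG 1 0 c) g := by
  refine ⟨hU, (m₁ • ContinuousLinearMap.fst ℝ ℂ ℂ + m₂ • ContinuousLinearMap.snd ℝ ℂ ℂ).prod
    (m₃ • ContinuousLinearMap.fst ℝ ℂ ℂ + m₄ • ContinuousLinearMap.snd ℝ ℂ ℂ), 0, fun p => ?_,
    fun p hp => ⟨fun u => ?_, fun u v => ?_⟩⟩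
  · refine (hg p.1 p.2).trans ?_
    simp
  · simp [fieldS_apply]
  · rw [fieldG_apply, fieldG_apply, ← hc p hp]
    simp
    ring

end Symm

/-! ### Lee forms on the covering -/

section Lee

variable {M : Type*} [TopologicalSpace M] [ChartedSpace C2 M] [IsManifold 𝓘(ℝ, C2) ∞ M]
variable {π : C2 → M} {U : Set C2} {σ : M → C2}

lemma bracket_eq_zero_of_constant_lift (h : IsCover π U) {p : C2} (hp : p ∈ U) {X Y : VectField M}
    {u v : C2} (hX : SmoothVectAt X (π p)) (hY : SmoothVectAt Y (π p))
    (hXu : liftV π X =ᶠ[𝓝 p] fun _ => u) (hYv : liftV π Y =ᶠ[𝓝 p] fun _ => v) :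
    bracket X Y (π p) = 0 := by
  have h1 := liftV_bracket h hp hX hY
  rw [hXu.fderiv_eq, hYv.fderiv_eq] at h1
  have h2 := dcov_liftV h hp (bracket X Y)
  rw [h1] at h2
  refine h2.symm.trans ?_
  simp only [fderiv_fun_const, Pi.zero_apply, zero_apply, sub_zero, map_zero]
  rfl

/-- The Lee equation `dΩ = θ ∧ Ω`, written on the covering with constant vector fields `u`, `v`, `w`,
whose brackets vanish. -/
lemma extD2_lift (h : IsCover π U) {Ω : BilinField M} {θ : CovectorField M}
    {η : C2 → C2 → C2 → ℝ}
    (hη : ∀ p ∈ U, ∀ X Y : VectField M, Ω (π p) (X (π p)) (Y (π p)) =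
      η p (liftV π X p) (liftV π Y p))
    (hd : ∀ p ∈ U, ∀ u v, DifferentiableAt ℝ (fun p => η p u v) p)
    (hΩ : ∀ (x : M) (X Y Z : VectField M), SmoothVectAt X x → SmoothVectAt Y x →
      SmoothVectAt Z x → extD2 Ω X Y Z x = wedge12 θ Ω x (X x) (Y x) (Z x))
    {p : C2} (hp : p ∈ U) (u v w : C2) :
    fderiv ℝ (fun p => η p v w) p u - fderiv ℝ (fun p => η p u w) p v +
      fderiv ℝ (fun p => η p u v) p w =
    θ (π p) (dcov π p u) * η p v w - θ (π p) (dcov π p v) * η p u w +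
      θ (π p) (dcov π p w) * η p u v := by
  obtain ⟨X, hX, hXu⟩ := exists_constant_lift h hp u
  obtain ⟨Y, hY, hYv⟩ := exists_constant_lift h hp v
  obtain ⟨Z, hZ, hZw⟩ := exists_constant_lift h hp w
  have h1 := hΩ (π p) X Y Z hX hY hZ
  have hD : ∀ (A B C : VectField M) (a b c : C2), liftV π A =ᶠ[𝓝 p] (fun _ => a) →
      liftV π B =ᶠ[𝓝 p] (fun _ => b) → liftV π C =ᶠ[𝓝 p] (fun _ => c) →
      lieD A (fun y => Ω y (B y) (C y)) (π p) = fderiv ℝ (fun p => η p b c) p a := by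
    intro A B C a b c hA hB hC
    have e : (fun y => Ω y (B y) (C y)) ∘ π =ᶠ[𝓝 p] fun p => η p b c := by
      filter_upwards [hB, hC, h.isOpen.mem_nhds hp] with x hx1 hx2 hx
      rw [Function.comp_apply, hη x hx, hx1, hx2]
    rw [lieD_eq h hp A ((hd p hp b c).congr_of_eventuallyEq e), e.fderiv_eq, hA.self_of_nhds]
  have hx : X (π p) = dcov π p u := by rw [← dcov_liftV h hp X, hXu.self_of_nhds]
  have hy : Y (π p) = dcov π p v := by rw [← dcov_liftV h hp Y, hYv.self_of_nhds]
  have hz : Z (π p) = dcov π p w := by rw [← dcov_liftV h hp Z, hZw.self_of_nhds]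
  have b1 := bracket_eq_zero_of_constant_lift h hp hX hY hXu hYv
  have b2 := bracket_eq_zero_of_constant_lift h hp hX hZ hXu hZw
  have b3 := bracket_eq_zero_of_constant_lift h hp hY hZ hYv hZw
  have hz0 : ∀ w : Tan M (π p), Ω (π p) 0 w = 0 := fun w => by rw [map_zero]; rfl
  rw [extD2, wedge12, hD X Y Z u v w hXu hYv hZw, hD Y X Z v u w hYv hXu hZw,
    hD Z X Y w u v hZw hXu hYv, b1, b2, b3, hz0, hz0, hz0, hη p hp, hη p hp, hη p hp, hXu.self_of_nhds,
    hYv.self_of_nhds, hZw.self_of_nhds, hx, hy, hz] at h1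
  simpa using h1

/-- Closedness of a `1`-form, written on the covering with constant vector fields. -/
lemma extD1_lift (h : IsCover π U) {θ : CovectorField M} {p : C2} (hp : p ∈ U) (u v : C2)
    (hu : DifferentiableAt ℝ (fun p => θ (π p) (dcov π p u)) p)
    (hv : DifferentiableAt ℝ (fun p => θ (π p) (dcov π p v)) p)
    (hθ : ∀ (x : M) (X Y : VectField M), SmoothVectAt X x → SmoothVectAt Y x →
      extD1 θ X Y x = 0) :
    fderiv ℝ (fun p => θ (π p) (dcov π p v)) p u =
      fderiv ℝ (fun p => θ (π p) (dcov π p u)) p v := by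
  obtain ⟨X, hX, hXu⟩ := exists_constant_lift h hp u
  obtain ⟨Y, hY, hYv⟩ := exists_constant_lift h hp v
  have h1 := hθ (π p) X Y hX hY
  have hD : ∀ (A B : VectField M) (a b : C2), liftV π A =ᶠ[𝓝 p] (fun _ => a) →
      liftV π B =ᶠ[𝓝 p] (fun _ => b) →
      DifferentiableAt ℝ (fun p => θ (π p) (dcov π p b)) p →
      lieD A (fun y => θ y (B y)) (π p) = fderiv ℝ (fun p => θ (π p) (dcov π p b)) p a := by
    intro A B a b hA hB hd
    have e : (fun y => θ y (B y)) ∘ π =ᶠ[𝓝 p] fun p => θ (π p) (dcov π p b) := by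
      filter_upwards [hB, h.isOpen.mem_nhds hp] with x hx1 hx
      rw [Function.comp_apply, ← hx1, dcov_liftV h hx B]
    rw [lieD_eq h hp A (hd.congr_of_eventuallyEq e), e.fderiv_eq, hA.self_of_nhds]
  rw [extD1, hD X Y u v hXu hYv hv, hD Y X v u hYv hXu hu,
    bracket_eq_zero_of_constant_lift h hp hX hY hXu hYv, map_zero, sub_zero] at h1
  exact sub_eq_zero.1 h1

end Lee

/-! ### Families of model structures -/

section Model

variable {M : Type*} [TopologicalSpace M] [ChartedSpace C2 M] [IsManifold 𝓘(ℝ, C2) ∞ M]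
variable {π : C2 → M} {U : Set C2} {σ : M → C2} {s : Set (Equiv.Perm C2)}

lemma mulI_comp_fieldS (q : ℂ → ℂ) (φ : ℂ → ℝ) : (fun p => mulI.comp (fieldS q φ p)) =
    fun p : C2 => modelS (Complex.I * q p.1 ^ 2) (Complex.I * (Complex.I * φ p.1 * q p.1))
      Complex.I := by
  funext p
  refine ContinuousLinearMap.ext fun u => ?_
  rw [ContinuousLinearMap.comp_apply, mulI_apply, fieldS_apply, modelS_apply]
  refine Prod.ext ?_ ?_
  · simp only [Prod.smul_mk, smul_eq_mul]
    ring
  · simp only [Prod.smul_mk, smul_eq_mul]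
    ring

/-- The model para-hyperhermitian structure on the covering, when the generators of the deck group
are symmetries of it. -/
def modelPHH (h : IsQuotientCover π U s) {W : Set ℂ} (hW : IsOpen W) (hUW : ∀ p ∈ U, p.1 ∈ W)
    {q : ℂ → ℂ} {φ : ℂ → ℝ} {c : C2 → ℝ} (hq : ContDiffOn ℝ ∞ q W) (hφ : ContDiffOn ℝ ∞ φ W)
    (hc : ContDiffOn ℝ ∞ c U) (hq1 : ∀ z ∈ W, q z * (starRingEnd ℂ) (q z) = 1)
    (hc0 : ∀ p ∈ U, c p ≠ 0)
    (hs : ∀ g ∈ s, IsAffineSymm U (fieldS q φ) (fieldG q φ c) g) : FlatPHH π U where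
  S := fieldS q φ
  g := fieldG q φ c
  smooth_S := by
    have h1 : ContDiffOn ℝ ∞ (fun z => (φ z : ℂ)) W :=
      Complex.ofRealCLM.contDiff.comp_contDiffOn hφ
    have h2 : ContDiffOn ℝ ∞ (fun z => Complex.I * (φ z : ℂ) * q z) W := by fun_prop
    exact contDiffOn_modelS ((hq.pow 2).comp contDiffOn_fst hUW) (h2.comp contDiffOn_fst hUW)
  smooth_g := contDiffOn_modelG hc (hφ.comp contDiffOn_fst hUW)
    ((contDiffOn_const.mul hq).comp contDiffOn_fst hUW)
  S_sq p hp u := fieldS_sq (hq1 _ (hUW p hp)) u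
  anticomm p _ u := fieldS_I p u
  nijenhuis_S p hp u v := by
    have h1 : ContDiffOn ℝ ∞ (fun z => (φ z : ℂ)) W :=
      Complex.ofRealCLM.contDiff.comp_contDiffOn hφ
    have h2 : ContDiffOn ℝ ∞ (fun z => Complex.I * (φ z : ℂ) * q z) W := by fun_prop
    refine flatNijenhuis_modelS hW (hq.pow 2) h2 (fun z hz => ?_) (fun z hz => ?_) (hUW p hp) u v
    · rw [map_pow, ← mul_pow, hq1 z hz, one_pow]
    · simp only [map_mul, map_pow, Complex.conj_I, Complex.conj_ofReal]
      linear_combination Complex.I * φ z * (starRingEnd ℂ) (q z) * hq1 z hz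
  nijenhuis_T p hp u v := by
    have h1 : ContDiffOn ℝ ∞ (fun z => (φ z : ℂ)) W :=
      Complex.ofRealCLM.contDiff.comp_contDiffOn hφ
    have h2 : ContDiffOn ℝ ∞ (fun z => Complex.I * (Complex.I * (φ z : ℂ) * q z)) W := by fun_prop
    rw [mulI_comp_fieldS]
    refine flatNijenhuis_modelS hW (contDiffOn_const.mul (hq.pow 2)) h2 (fun z hz => ?_)
      (fun z hz => ?_) (hUW p hp) u v
    · rw [map_mul, map_pow, Complex.conj_I]
      linear_combination (q z * (starRingEnd ℂ) (q z) + 1) * hq1 z hz -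
        (q z * (starRingEnd ℂ) (q z)) ^ 2 * Complex.I_sq
    · simp only [map_mul, map_pow, Complex.conj_I, Complex.conj_ofReal]
      linear_combination (-Complex.I ^ 3 * φ z * (starRingEnd ℂ) (q z)) * hq1 z hz
  symm p _ u v := fieldG_symm p u v
  nondegenerate p hp u hu := fieldG_nondegenerate (hq1 _ (hUW p hp)) (hc0 p hp) u hu
  skew_I p _ u v := fieldG_I p u v
  skew_S p hp u v := fieldG_skew_S (hq1 _ (hUW p hp)) u v
  descends_S := h.endDescends hs
  descends_g := h.bilinDescends hs

/-- Evaluating a polynomial that depends linearly on parameters is smooth. -/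
lemma contDiffOn_eval {n : ℕ} {F : Type*} [NormedAddCommGroup F] [NormedSpace ℝ F] {A : Set F}
    (L : (Fin n → ℝ) →ₗ[ℝ] Polynomial ℝ) {t : F → ℝ} (ht : ContDiffOn ℝ ∞ t A) :
    ContDiffOn ℝ ∞ (fun z : (Fin n → ℝ) × F => (L z.1).eval (t z.2)) (univ ×ˢ A) := by
  have h1 : (fun z : (Fin n → ℝ) × F => (L z.1).eval (t z.2)) = fun z =>
      ∑ i, z.1 i * (L (Pi.single i 1)).eval (t z.2) := by
    funext z
    rw [LinearMap.pi_apply_eq_sum_univ L z.1, Polynomial.eval_finsetSum]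
    simp only [Polynomial.eval_smul, smul_eq_mul]
    refine Finset.sum_congr rfl fun i _ => ?_
    congr 3
    funext j
    simp [Pi.single_apply, eq_comm]
  rw [h1]
  refine ContDiffOn.sum fun i _ => ContDiffOn.mul ?_ ?_
  · exact (contDiff_apply ℝ ℝ i |>.comp contDiff_fst).contDiffOn
  · exact ((L (Pi.single i 1)).contDiff_aeval ∞).comp_contDiffOn
      (ht.comp contDiffOn_snd fun z hz => hz.2)

end Model

/-! ### Structures that are not locally conformally para-hyperkähler -/

section NonLCPK

/-- The unitary function `exp (i sin (2π l(z)))`, invariant under translations by vectors on which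
the real linear form `l` is an integer. -/
def phase (l : ℂ →L[ℝ] ℝ) (z : ℂ) : ℂ := Complex.exp (Real.sin (2 * Real.pi * l z) * Complex.I)

lemma contDiff_phase (l : ℂ →L[ℝ] ℝ) : ContDiff ℝ ∞ (phase l) := by
  have h1 : ContDiff ℝ ∞ (fun z => ((Real.sin (2 * Real.pi * l z) : ℝ) : ℂ)) :=
    Complex.ofRealCLM.contDiff.comp (Real.contDiff_sin.comp (contDiff_const.mul l.contDiff))
  exact (h1.mul contDiff_const).cexp

lemma phase_mul_conj (l : ℂ →L[ℝ] ℝ) (z : ℂ) : phase l z * (starRingEnd ℂ) (phase l z) = 1 := by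
  rw [Complex.mul_conj', phase, Complex.norm_exp_ofReal_mul_I]
  simp

/-- The coefficient `k = i q̄` of `dz ∧ dw` satisfies `dk = -i k d(sin 2πl)`. -/
lemma hasFDerivAt_conj_phase (l : ℂ →L[ℝ] ℝ) (z : ℂ) :
    ∃ K : ℂ →L[ℝ] ℂ, HasFDerivAt (fun z => Complex.I * (starRingEnd ℂ) (phase l z)) K z ∧
      ∀ ζ, K ζ = -Complex.I * (2 * Real.pi * l ζ * Real.cos (2 * Real.pi * l z) : ℝ) *
        (Complex.I * (starRingEnd ℂ) (phase l z)) := by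
  have h1 : HasFDerivAt (fun z => Real.sin (2 * Real.pi * l z)) _ z :=
    (l.hasFDerivAt.const_mul (2 * Real.pi)).sin
  have h2 := (Complex.ofRealCLM.hasFDerivAt.comp z h1).mul_const (-Complex.I)
  have h3 := h2.cexp.const_mul Complex.I
  have h4 : ∀ z, (starRingEnd ℂ) (phase l z) =
      Complex.exp (Complex.ofRealCLM (Real.sin (2 * Real.pi * l z)) * -Complex.I) := by
    intro z
    rw [phase, ← Complex.exp_conj, map_mul, Complex.conj_I, Complex.conj_ofReal]
    rfl
  refine ⟨_, h3.congr_of_eventuallyEq (Eventually.of_forall fun z => by simp only [h4]; rfl), ?_⟩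
  intro ζ
  rw [h4]
  simp
  ring

variable {M : Type*} [TopologicalSpace M] [ChartedSpace C2 M] [IsManifold 𝓘(ℝ, C2) ∞ M]
variable {π : C2 → M} {σ : M → C2}

/-- With `v = sin (2πl)` and `z = x + i y`, the Lee form satisfies `θ(∂ₓ) = v_y` and `θ(∂_y) = -v_x`.
Hence `dθ(∂ₓ, ∂_y)` is minus the Laplacian of `v`, which does not vanish where `v = 1`. -/
lemma not_isLCPK_of_phase (F : FlatPHH π univ) (h : IsHolCover π univ)
    (hσ : ∀ x, σ x ∈ univ ∧ π (σ x) = x) {l : ℂ →L[ℝ] ℝ} {z₀ : ℂ} (hl : l z₀ = 1) {φ : ℂ → ℝ}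
    (hS : F.S = fieldS (phase l) φ) (hg : F.g = fieldG (phase l) φ (fun _ => 1)) :
    ¬ (F.toPHH h hσ).IsLCPK := by
  rintro ⟨θ, ⟨-, hθ⟩, hcl⟩
  set k : ℂ → ℂ := fun z => Complex.I * (starRingEnd ℂ) (phase l z) with hk
  have hdk : ∀ z, DifferentiableAt ℝ k z := fun z =>
    (hasFDerivAt_conj_phase l z).choose_spec.1.differentiableAt
  have hk' : ∀ z ζ, fderiv ℝ k z ζ =
      -Complex.I * (2 * Real.pi * l ζ * Real.cos (2 * Real.pi * l z) : ℝ) * k z := by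
    intro z ζ
    obtain ⟨K, h1, h2⟩ := hasFDerivAt_conj_phase l z
    rw [h1.fderiv, h2]
  have hk0 : ∀ z, k z ≠ 0 := fun z =>
    mul_ne_zero Complex.I_ne_zero (right_ne_zero_of_mul_eq_one (phase_mul_conj l z))
  have hΩS : ∀ p ∈ (univ : Set C2), ∀ X Y : VectField M,
      fundForm (F.toPHH h hσ).g (F.toPHH h hσ).S (π p) (X (π p)) (Y (π p)) =
      (k p.1 * ((liftV π X p).1 * (liftV π Y p).2 - (liftV π X p).2 * (liftV π Y p).1)).re := by
    intro p hp X Y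
    have h1 : fundForm (F.toPHH h hσ).g (F.toPHH h hσ).S (π p) (X (π p)) (Y (π p)) =
      F.g p (liftV π ((pushEnd π σ F.S).app X) p) (liftV π Y p) :=
      pushBilin_apply hσ F.descends_g hp _ _
    rw [h1, liftV_app h.toIsCover hσ F.descends_S X hp, hS, hg, fieldG_fieldS (phase_mul_conj l _),
      one_mul]
  have hΩT : ∀ p ∈ (univ : Set C2), ∀ X Y : VectField M,
      fundForm (F.toPHH h hσ).g (F.toPHH h hσ).T (π p) (X (π p)) (Y (π p)) =
      (k p.1 * ((liftV π X p).1 * (liftV π Y p).2 - (liftV π X p).2 * (liftV π Y p).1)).im := by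
    intro p hp X Y
    have h1 : fundForm (F.toPHH h hσ).g (F.toPHH h hσ).T (π p) (X (π p)) (Y (π p)) =
      F.g p (liftV π ((pushEnd π σ (fun p => mulI.comp (F.S p))).app X) p) (liftV π Y p) :=
      pushBilin_apply hσ F.descends_g hp _ _
    rw [h1, liftV_app h.toIsCover hσ (F.descends_S.mulI_comp h) X hp,
      ContinuousLinearMap.comp_apply, mulI_apply, F.skew_I p hp, hS, hg,
      fieldG_fieldS (phase_mul_conj l _), one_mul]
    simp [hk]
    ring
  have dRe : ∀ (p : C2) (a : ℂ) (u : C2), fderiv ℝ (fun p : C2 => (k p.1 * a).re) p u =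
      (fderiv ℝ k p.1 u.1 * a).re := by
    intro p a u
    have h1 := Complex.reCLM.hasFDerivAt.comp p
      (((hdk p.1).hasFDerivAt.comp p hasFDerivAt_fst).mul_const a)
    have h2 := h1.fderiv
    have h3 := congrArg (fun L : C2 →L[ℝ] ℝ => L u) h2
    refine h3.trans ?_
    simp [mul_comm]
  have dIm : ∀ (p : C2) (a : ℂ) (u : C2), fderiv ℝ (fun p : C2 => (k p.1 * a).im) p u =
      (fderiv ℝ k p.1 u.1 * a).im := by
    intro p a u
    have h1 := Complex.imCLM.hasFDerivAt.comp p
      (((hdk p.1).hasFDerivAt.comp p hasFDerivAt_fst).mul_const a)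
    have h2 := h1.fderiv
    have h3 := congrArg (fun L : C2 →L[ℝ] ℝ => L u) h2
    refine h3.trans ?_
    simp [mul_comm]
  have hd : ∀ (p : C2) (a : ℂ), DifferentiableAt ℝ (fun p : C2 => k p.1 * a) p := fun p a =>
    ((hdk p.1).comp p differentiableAt_fst).mul_const a
  -- The real and imaginary parts of `k dz ∧ dw` are the fundamental forms of `S` and `T`.
  have key : ∀ p : C2, θ (π p) (dcov π p (1, 0)) =
        2 * Real.pi * l Complex.I * Real.cos (2 * Real.pi * l p.1) ∧
      θ (π p) (dcov π p (Complex.I, 0)) =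
        -(2 * Real.pi * l 1 * Real.cos (2 * Real.pi * l p.1)) := by
    intro p
    have e1 := extD2_lift h.toIsCover
      (η := fun p u v => (k p.1 * (u.1 * v.2 - u.2 * v.1)).re) hΩS
      (fun p _ u v => Complex.reCLM.differentiableAt.comp p (hd p _))
      (hθ (F.toPHH h hσ).S (by simp)) (mem_univ p) (1, 0) (Complex.I, 0) (0, 1)
    have e2 := extD2_lift h.toIsCover
      (η := fun p u v => (k p.1 * (u.1 * v.2 - u.2 * v.1)).im) hΩT
      (fun p _ u v => Complex.imCLM.differentiableAt.comp p (hd p _))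
      (hθ (F.toPHH h hσ).T (by simp)) (mem_univ p) (1, 0) (Complex.I, 0) (0, 1)
    simp only [dRe, dIm, hk'] at e1 e2
    generalize θ (π p) (dcov π p (1, 0)) = θ₁ at e1 e2 ⊢
    generalize θ (π p) (dcov π p (Complex.I, 0)) = θ₂ at e1 e2 ⊢
    have e3 : (((2 * Real.pi * l 1 * Real.cos (2 * Real.pi * l p.1) + θ₂ : ℝ) : ℂ) +
        ((2 * Real.pi * l Complex.I * Real.cos (2 * Real.pi * l p.1) - θ₁ : ℝ) : ℂ) * Complex.I) *
        k p.1 = 0 := by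
      generalize 2 * Real.pi * l 1 * Real.cos (2 * Real.pi * l p.1) = x at e1 e2 ⊢
      generalize 2 * Real.pi * l Complex.I * Real.cos (2 * Real.pi * l p.1) = y at e1 e2 ⊢
      apply Complex.ext
      · simp at e1 ⊢
        linarith
      · simp at e2 ⊢
        linarith
    have e4 := (mul_eq_zero.1 e3).resolve_right (hk0 _)
    have e5 := congrArg Complex.re e4
    have e6 := congrArg Complex.im e4
    simp only [Complex.add_re, Complex.ofReal_re, Complex.mul_re, Complex.I_re, mul_zero,
      Complex.ofReal_im, Complex.I_im, mul_one, sub_self, add_zero, Complex.zero_re,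
      Complex.add_im, Complex.mul_im, zero_add, Complex.zero_im] at e5 e6
    exact ⟨by linarith, by linarith⟩
  have f1 : (fun p => θ (π p) (dcov π p (1, 0))) = fun p : C2 =>
      2 * Real.pi * l Complex.I * Real.cos (2 * Real.pi * l p.1) := funext fun p => (key p).1
  have f2 : (fun p => θ (π p) (dcov π p (Complex.I, 0))) = fun p : C2 =>
      -(2 * Real.pi * l 1 * Real.cos (2 * Real.pi * l p.1)) := funext fun p => (key p).2
  have hcos : ∀ (a : ℝ) (p : C2), HasFDerivAt (fun p : C2 => a * Real.cos (2 * Real.pi * l p.1))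
      (a • -(Real.sin (2 * Real.pi * l p.1)) • (2 * Real.pi) •
        l.comp (ContinuousLinearMap.fst ℝ ℂ ℂ)) p := fun a p =>
    (((l.hasFDerivAt.comp p hasFDerivAt_fst).const_mul (2 * Real.pi)).cos).const_mul a
  have hcos' : ∀ (a : ℝ) (p : C2), HasFDerivAt
      (fun p : C2 => -(a * Real.cos (2 * Real.pi * l p.1)))
      (-(a • -(Real.sin (2 * Real.pi * l p.1)) • (2 * Real.pi) •
        l.comp (ContinuousLinearMap.fst ℝ ℂ ℂ))) p := fun a p => (hcos a p).neg
  -- A point where `sin (2πl) = 1`.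
  set p₀ : C2 := ((1 / 4 : ℝ) • z₀, 0) with hp₀
  have e := extD1_lift h.toIsCover (mem_univ p₀) (1, 0) (Complex.I, 0)
    (by rw [f1]; exact (hcos _ _).differentiableAt)
    (by rw [f2]; exact (hcos' _ _).differentiableAt) hcl
  rw [f1, f2, (hcos _ _).fderiv, (hcos' _ _).fderiv] at e
  have hsin : Real.sin (2 * Real.pi * l p₀.1) = 1 := by
    rw [hp₀, map_smul, hl, ← Real.sin_pi_div_two]
    congr 1
    simp
    ring
  have e' : (2 * Real.pi) ^ 2 * (l 1 ^ 2 + l Complex.I ^ 2) = 0 := by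
    simp [hsin] at e
    linear_combination e
  have hpi : (2 * Real.pi) ^ 2 ≠ 0 := by positivity
  have e7 := (mul_eq_zero.1 e').resolve_left hpi
  have l1 : l 1 = 0 := by nlinarith [sq_nonneg (l 1), sq_nonneg (l Complex.I)]
  have l2 : l Complex.I = 0 := by nlinarith [sq_nonneg (l 1), sq_nonneg (l Complex.I)]
  have h1 : z₀ = z₀.re • (1 : ℂ) + z₀.im • Complex.I := by apply Complex.ext <;> simp
  rw [h1, map_add, map_smul, map_smul, l1, l2] at hl
  simp at hl

end NonLCPK

/-! ### Infinite-dimensional families -/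

section Families

variable {M : Type*} [TopologicalSpace M] [ChartedSpace C2 M] [IsManifold 𝓘(ℝ, C2) ∞ M]
variable {π : C2 → M} {U : Set C2} {s : Set (Equiv.Perm C2)}

/-- The models with `φ = P(t) κ + φ₀`, for `P` in the space of real polynomials. The polynomial `P`
can be recovered from `S`, since `t` takes infinitely many values. -/
lemma hasInfDimFamilyModConformal_of_model (h : IsQuotientCover π U s) {W : Set ℂ}
    (hW : IsOpen W) (hUW : ∀ p ∈ U, p.1 ∈ W) {q : ℂ → ℂ} {t κ φ₀ : ℂ → ℝ} {c : C2 → ℝ}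
    (hq : ContDiffOn ℝ ∞ q W) (ht : ContDiffOn ℝ ∞ t W) (hκ : ContDiffOn ℝ ∞ κ W)
    (hφ₀ : ContDiffOn ℝ ∞ φ₀ W) (hc : ContDiffOn ℝ ∞ c U)
    (hq1 : ∀ z ∈ W, q z * (starRingEnd ℂ) (q z) = 1) (hc0 : ∀ p ∈ U, c p ≠ 0)
    (hκ0 : ∀ z ∈ W, κ z ≠ 0) (htU : ((fun p : C2 => t p.1) '' U).Infinite)
    (hs : ∀ P : Polynomial ℝ, ∀ g ∈ s,
      IsAffineSymm U (fieldS q fun z => P.eval (t z) * κ z + φ₀ z)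
        (fieldG q (fun z => P.eval (t z) * κ z + φ₀ z) c) g)
    {A : Set (ParaHyperhermitian M)}
    (hA : ∀ (F : FlatPHH π U) (σ : M → C2) (hσ : ∀ x, σ x ∈ U ∧ π (σ x) = x) (φ : ℂ → ℝ),
      F.S = fieldS q φ → F.g = fieldG q φ c → F.toPHH h.toIsHolCover hσ ∈ A) :
    HasInfDimFamilyModConformal A := by
  choose σ hσ using h.surj
  have hφ : ∀ P : Polynomial ℝ, ContDiffOn ℝ ∞ (fun z => P.eval (t z) * κ z + φ₀ z) W := fun P =>
    (((P.contDiff_aeval ∞).comp_contDiffOn ht).mul hκ).add hφ₀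
  let F : Polynomial ℝ → FlatPHH π U := fun P => modelPHH h hW hUW hq (hφ P) hc hq1 hc0 (hs P)
  have hfam : ∀ (n : ℕ) (L : (Fin n → ℝ) →ₗ[ℝ] Polynomial ℝ), ContDiffOn ℝ ∞
      (fun z : (Fin n → ℝ) × C2 => (L z.1).eval (t z.2.1) * κ z.2.1 + φ₀ z.2.1) (univ ×ˢ U) := by
    intro n L
    have h1 : MapsTo (fun z : (Fin n → ℝ) × C2 => z.2.1) (univ ×ˢ U) W := fun z hz => hUW _ hz.2
    have h2 : ContDiffOn ℝ ∞ (fun z : (Fin n → ℝ) × C2 => z.2.1) (univ ×ˢ U) := by fun_prop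
    have h3 := (contDiffOn_eval L ht).comp
      (contDiffOn_fst.prodMk h2 : ContDiffOn ℝ ∞ (fun z : (Fin n → ℝ) × C2 => (z.1, z.2.1)) _)
      fun z hz => ⟨mem_univ _, h1 hz⟩
    exact (h3.mul (hκ.comp h2 h1)).add (hφ₀.comp h2 h1)
  have h2 : ∀ n : ℕ, ContDiffOn ℝ ∞ (fun z : (Fin n → ℝ) × C2 => q z.2.1) (univ ×ˢ U) := fun n =>
    hq.comp (t := W) (f := fun z : (Fin n → ℝ) × C2 => z.2.1) (by fun_prop)
      fun z hz => hUW _ hz.2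
  refine ⟨Polynomial ℝ, inferInstance, inferInstance, Polynomial.not_finite,
    fun P => (F P).toPHH h.toIsHolCover hσ, ?_, fun P => hA (F P) σ hσ (fun z => P.eval (t z) * κ z + φ₀ z) rfl rfl, ?_⟩
  · refine FlatPHH.isSmoothFamily h.toIsHolCover hσ F (fun n L => ?_) (fun n L => ?_)
    · have h3 : ContDiffOn ℝ ∞ (fun z : (Fin n → ℝ) × C2 =>
          (((L z.1).eval (t z.2.1) * κ z.2.1 + φ₀ z.2.1 : ℝ) : ℂ)) (univ ×ˢ U) :=
        Complex.ofRealCLM.contDiff.comp_contDiffOn (hfam n L)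
      exact contDiffOn_modelS ((h2 n).pow 2) ((contDiffOn_const.mul h3).mul (h2 n))
    · exact contDiffOn_modelG (hc.comp contDiffOn_snd fun z hz => hz.2) (hfam n L)
        (contDiffOn_const.mul (h2 n))
  · intro P P' hPP
    refine Polynomial.eq_of_infinite_eval_eq P P' (htU.mono ?_)
    rintro _ ⟨p, hp, rfl⟩
    -- The two structures have the same coefficient of `S`, and `q` does not vanish.
    have h3 := congrArg (fun A : C2 →L[ℝ] C2 => (A (1, 0)).2)
      (FlatPHH.S_eq_of_toPHH_eq (F P) (F P') h.toIsHolCover hσ hPP hp)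
    have h4 : (fieldS q (fun z => P.eval (t z) * κ z + φ₀ z) p (1, 0)).2 =
      (fieldS q (fun z => P'.eval (t z) * κ z + φ₀ z) p (1, 0)).2 := h3
    rw [fieldS_apply, fieldS_apply] at h4
    have hq0 : q p.1 ≠ 0 := left_ne_zero_of_mul_eq_one (hq1 _ (hUW p hp))
    have h5 := hκ0 _ (hUW p hp)
    simpa [hq0, h5] using h4

/-- On a quotient by real linear maps, the conformal metrics with `c = exp (P ∘ f) c₀`, for `P` in the
space of real polynomials. -/
lemma hasInfDimFamily_of_real (h : IsQuotientCover π U s) {c₀ : C2 → ℝ}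
    (hc : ContDiffOn ℝ ∞ c₀ U) (hc0 : ∀ p ∈ U, c₀ p ≠ 0)
    (hs : ∀ g ∈ s, ∃ m₁ m₂ m₃ m₄ : ℝ, (∀ p, p ∈ U ↔ g p ∈ U) ∧
      (∀ z w : ℂ, g (z, w) = (m₁ * z + m₂ * w, m₃ * z + m₄ * w)) ∧
      ∀ p ∈ U, c₀ (g p) * (m₁ * m₄ - m₂ * m₃) = c₀ p)
    {f : M → ℝ} (hf : ContMDiff 𝓘(ℝ, C2) 𝓘(ℝ, ℝ) ∞ f) (hfr : (range f).Infinite)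
    {A : Set (ParaHyperhermitian M)}
    (hA : ∀ Q : ParaHyperhermitian M, Q.I = complexStructure M → Q ∈ A) :
    HasInfDimFamily A := by
  choose σ hσ using h.surj
  have hfU : ContDiffOn ℝ ∞ (fun p => f (π p)) U := fun p hp =>
    ((hf.contMDiffAt.comp p (h.toIsCover.contMDiffAt hp)).contDiffAt).contDiffWithinAt
  let c : Polynomial ℝ → C2 → ℝ := fun P p => Real.exp (P.eval (f (π p))) * c₀ p
  have hfam : ∀ (n : ℕ) (L : (Fin n → ℝ) →ₗ[ℝ] Polynomial ℝ), ContDiffOn ℝ ∞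
      (fun z : (Fin n → ℝ) × C2 => c (L z.1) z.2) (univ ×ˢ U) := fun n L =>
    (contDiffOn_eval L hfU).exp.mul (hc.comp contDiffOn_snd fun z hz => hz.2)
  have hcP : ∀ P, ContDiffOn ℝ ∞ (c P) U := fun P =>
    ((P.contDiff_aeval ∞).comp_contDiffOn hfU).exp.mul hc
  have hcP0 : ∀ P, ∀ p ∈ U, c P p ≠ 0 := fun P p hp =>
    mul_ne_zero (Real.exp_pos _).ne' (hc0 p hp)
  have hsP : ∀ P, ∀ g ∈ s, IsAffineSymm U (fieldS 1 0) (fieldG 1 0 (c P)) g := by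
    intro P g hg
    obtain ⟨m₁, m₂, m₃, m₄, hU, hm, hcg⟩ := hs g hg
    refine isAffineSymm_real hU m₁ m₂ m₃ m₄ hm fun p hp => ?_
    -- The conformal factor `exp (P ∘ f)` lives on the quotient, so it is invariant.
    have h1 : π (g p) = π p :=
      ((h.fibre p hp (g p) ((hU p).1 hp)).2 ⟨g, Subgroup.subset_closure hg, rfl⟩).symm
    simp only [c, h1]
    rw [mul_assoc, hcg p hp]
  let F : Polynomial ℝ → FlatPHH π U := fun P => modelPHH h isOpen_univ (fun _ _ => mem_univ _)
    (q := 1) (φ := 0) contDiffOn_const contDiffOn_const (hcP P) (fun z _ => by simp) (hcP0 P)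
    (hsP P)
  refine ⟨Polynomial ℝ, inferInstance, inferInstance, Polynomial.not_finite,
    fun P => (F P).toPHH h.toIsHolCover hσ, ?_, fun P => hA _ rfl, ?_⟩
  · refine FlatPHH.isSmoothFamily h.toIsHolCover hσ F (fun n L => ?_) (fun n L => ?_)
    · refine contDiffOn_modelS ?_ ?_ <;>
      · simp only [Pi.zero_apply, Pi.one_apply]
        exact contDiffOn_const
    · refine contDiffOn_modelG (hfam n L) contDiffOn_const ?_
      simp only [Pi.one_apply]
      exact contDiffOn_const
  · intro P P' hPP
    refine Polynomial.eq_of_infinite_eval_eq P P' (hfr.mono ?_)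
    rintro _ ⟨x, rfl⟩
    obtain ⟨hx, hx'⟩ := hσ x
    -- The metrics differ by their factor `c`, which is read off a pair of vectors with product `1`.
    have h3 : fieldG 1 0 (c P) (σ x) (1, 0) (0, -Complex.I) =
        fieldG 1 0 (c P') (σ x) (1, 0) (0, -Complex.I) :=
      FlatPHH.g_eq_of_toPHH_eq (F P) (F P') h.toIsHolCover hσ hPP hx _ _
    have h5 := hc0 _ hx
    simpa [fieldG_apply, c, h5, hx'] using h3

/-- There is a smooth function with infinitely many values: a bump function takes all values between
`0` and `1`. -/
lemma exists_contMDiff_infinite_range [T2Space M] [Nonempty M] :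
    ∃ f : M → ℝ, ContMDiff 𝓘(ℝ, C2) 𝓘(ℝ, ℝ) ∞ f ∧ (range f).Infinite := by
  obtain ⟨x⟩ := ‹Nonempty M›
  obtain ⟨f⟩ := (inferInstance : Nonempty (SmoothBumpFunction 𝓘(ℝ, C2) x))
  refine ⟨f, f.contMDiff, (Icc_infinite (zero_lt_one (α := ℝ))).mono ?_⟩
  set e := extChartAt 𝓘(ℝ, C2) x
  -- The bump function along a segment issuing from the centre of the chart.
  let γ : ℝ → C2 := fun t => e x + t • ((1, 0) : C2)
  have hγd : ∀ t, dist (γ t) (e x) = |t| := fun t => by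
    rw [dist_eq_norm]
    simp only [γ, add_sub_cancel_left, norm_smul]
    simp
  have hcont : ContinuousOn (fun t => f.toContDiffBump (γ t)) (Icc 0 f.rOut) :=
    (f.toContDiffBump.continuous.comp (by fun_prop)).continuousOn
  have h0 : f.toContDiffBump (γ 0) = 1 :=
    f.toContDiffBump.one_of_mem_closedBall (by
      rw [Metric.mem_closedBall, hγd, abs_zero]; exact f.rIn_pos.le)
  have h1 : f.toContDiffBump (γ f.rOut) = 0 :=
    f.toContDiffBump.zero_of_le_dist (by rw [hγd, abs_of_pos f.rOut_pos])
  intro y hy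
  have h2 := intermediate_value_Icc' f.rOut_pos.le hcont
  simp only [h0, h1] at h2
  obtain ⟨t, ht, rfl⟩ := h2 hy
  have h3 : γ t ∈ e.target := f.closedBall_subset ⟨by
    rw [Metric.mem_closedBall, hγd, abs_of_nonneg ht.1]; exact ht.2, by simp⟩
  refine ⟨e.symm (γ t), ?_⟩
  have h4 : e.symm (γ t) ∈ (chartAt C2 x).source := by
    rw [← extChartAt_source 𝓘(ℝ, C2)]; exact e.map_target h3
  rw [f.eqOn_source h4, Function.comp_apply, e.right_inv h3]

end Families

/-! ### The surfaces -/

section Surfaces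

variable {M : Type*} [TopologicalSpace M] [ChartedSpace C2 M] [IsManifold 𝓘(ℂ, C2) ω M]

lemma HasInfDimFamilyModConformal.mono {A B : Set (ParaHyperhermitian M)} (hAB : A ⊆ B)
    (h : HasInfDimFamilyModConformal A) : HasInfDimFamilyModConformal B := by
  obtain ⟨V, i₁, i₂, hV, Φ, h1, h2, h3⟩ := h
  exact ⟨V, i₁, i₂, hV, Φ, h1, fun v => hAB (h2 v), h3⟩

lemma HasInfDimFamilyModConformal.hasInfDimFamily {A : Set (ParaHyperhermitian M)}
    (h : HasInfDimFamilyModConformal A) : HasInfDimFamily A := by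
  obtain ⟨V, i₁, i₂, hV, Φ, h1, h2, h3⟩ := h
  exact ⟨V, i₁, i₂, hV, Φ, h1, h2, fun v w hvw => h3 (congrArg _ hvw)⟩

/-- The complex linear automorphism of `ℂ²` with a given invertible matrix. -/
lemma exists_linearEquiv {α β γ δ : ℂ} (h : α * δ - β * γ ≠ 0) :
    ∃ e : C2 ≃L[ℂ] C2, ∀ p, e p = (α * p.1 + β * p.2, γ * p.1 + δ * p.2) := by
  let f : C2 →ₗ[ℂ] C2 := (α • LinearMap.fst ℂ ℂ ℂ + β • LinearMap.snd ℂ ℂ ℂ).prod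
    (γ • LinearMap.fst ℂ ℂ ℂ + δ • LinearMap.snd ℂ ℂ ℂ)
  have hf : Function.Injective f := by
    refine (injective_iff_map_eq_zero f).2 fun p hp => ?_
    have h1 : α * p.1 + β * p.2 = 0 := congrArg Prod.fst hp
    have h2 : γ * p.1 + δ * p.2 = 0 := congrArg Prod.snd hp
    refine Prod.ext ((mul_eq_zero.1 ?_).resolve_left h) ((mul_eq_zero.1 ?_).resolve_left h)
    · linear_combination δ * h1 - β * h2
    · linear_combination α * h2 - γ * h1
  exact ⟨(LinearEquiv.ofInjectiveEndo f hf).toContinuousLinearEquiv, fun p => rfl⟩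

variable {π : C2 → M} {s : Set (Equiv.Perm C2)}

/-- The common treatment of complex tori (`ε = 0`) and primary Kodaira surfaces (`ε = 1`): the
equivariance of `φ` is that of `2 ε Im (z̄ q)`. -/
lemma hasInfDimFamilyModConformal_of_translations (h : IsQuotientCover π univ s)
    {l : ℂ →L[ℝ] ℝ} {z₀ : ℂ} (hl : l z₀ = 1) (ε : ℝ)
    (hs : ∀ g ∈ s, ∃ a b : ℂ, (∃ n : ℤ, l a = n) ∧
      ∀ z w : ℂ, g (z, w) = (z + a, w + ε * (starRingEnd ℂ) a * z + b)) :
    HasInfDimFamilyModConformal (compatibleNonLCPK M) := by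
  have hl' : ContDiff ℝ ∞ (fun z => 2 * Real.pi * l z) := contDiff_const.mul l.contDiff
  have hper : ∀ z a : ℂ, ∀ n : ℤ, l a = n → 2 * Real.pi * l (z + a) =
      2 * Real.pi * l z + n * (2 * Real.pi) := by
    intro z a n hn
    rw [map_add, hn]
    ring
  refine hasInfDimFamilyModConformal_of_model h isOpen_univ (fun _ _ => mem_univ _)
    (q := phase l) (t := fun z => Real.cos (2 * Real.pi * l z)) (κ := fun _ => 1)
    (φ₀ := fun z => 2 * ε * ((starRingEnd ℂ) z * phase l z).im) (c := fun _ => 1)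
    (contDiff_phase l).contDiffOn hl'.cos.contDiffOn contDiffOn_const ?_ contDiffOn_const
    (fun z _ => phase_mul_conj l z) (fun _ _ => one_ne_zero) (fun _ _ => one_ne_zero) ?_ ?_ ?_
  · exact (contDiff_const.mul (Complex.imCLM.contDiff.comp
      (Complex.conjCLE.contDiff.mul (contDiff_phase l)))).contDiffOn
  · refine (Icc_infinite (show (-1 : ℝ) < 1 by norm_num)).mono fun y hy =>
      ⟨((Real.arccos y / (2 * Real.pi)) • z₀, 0), mem_univ _, ?_⟩
    change Real.cos (2 * Real.pi * l ((Real.arccos y / (2 * Real.pi)) • z₀)) = y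
    rw [map_smul, hl, smul_eq_mul, mul_one, mul_div_cancel₀ _ (by positivity),
      Real.cos_arccos hy.1 hy.2]
  · intro P g hg
    obtain ⟨a, b, ⟨n, hn⟩, hg⟩ := hs g hg
    have hph : ∀ z, phase l (z + a) = phase l z := fun z => by
      rw [phase, phase, hper z a n hn, Real.sin_add_int_mul_two_pi]
    have hg1 : ∀ p : C2, (g p).1 = p.1 + a := fun p => congrArg Prod.fst (hg p.1 p.2)
    refine isAffineSymm_triangular (fun p => by simp) 1 (ε * (starRingEnd ℂ) a) a b
      (fun z w => by rw [hg, Complex.ofReal_one, one_mul]) (fun p _ => by rw [hg1, hph])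
      (fun p _ => phase_mul_conj l p.1) (fun p _ => ?_) (fun p _ => by rw [mul_one])
    rw [hg1, hph, hper p.1 a n hn, Real.cos_add_int_mul_two_pi, map_add, add_mul, Complex.add_im,
      mul_assoc (ε : ℂ), Complex.im_ofReal_mul]
    ring
  · intro F σ hσ φ hS hg
    exact ⟨rfl, not_isLCPK_of_phase F h.toIsHolCover hσ hl hS hg⟩

lemma IsComplexTorus.hasInfDimFamilyModConformal (h : IsComplexTorus M) :
    HasInfDimFamilyModConformal (compatibleNonLCPK M) := by
  obtain ⟨τ, h⟩ := h
  -- The complex linear form `α p.1 + β p.2` has as its real part the first coordinate with respect to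
  -- the basis of the lattice. It serves as the first coordinate of `ℂ²`.
  set α : ℂ := τ.coord 0 (1, 0) - τ.coord 0 (Complex.I, 0) * Complex.I
  set β : ℂ := τ.coord 0 (0, 1) - τ.coord 0 (0, Complex.I) * Complex.I
  have hre : ∀ p : C2, (α * p.1 + β * p.2).re = τ.coord 0 p := by
    intro p
    have h1 : p = p.1.re • ((1, 0) : C2) + p.1.im • ((Complex.I, 0) : C2) +
        p.2.re • ((0, 1) : C2) + p.2.im • ((0, Complex.I) : C2) := by
      refine Prod.ext ?_ ?_ <;> apply Complex.ext <;> simp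
    conv_rhs => rw [h1]
    simp only [map_add, map_smul, α, β]
    simp
    ring
  have hαβ : α * (starRingEnd ℂ) α - β * -(starRingEnd ℂ) β ≠ 0 := by
    intro h0
    have h1 : Complex.normSq α + Complex.normSq β = 0 := by
      rw [mul_neg, sub_neg_eq_add, Complex.mul_conj, Complex.mul_conj] at h0
      exact_mod_cast h0
    have h2 := Complex.normSq_nonneg α
    have h3 := Complex.normSq_nonneg β
    have hα : α = 0 := Complex.normSq_eq_zero.1 (by linarith)
    have hβ : β = 0 := Complex.normSq_eq_zero.1 (by linarith)
    have h4 := hre (τ 0)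
    rw [hα, hβ] at h4
    simp at h4
  obtain ⟨e, he⟩ := exists_linearEquiv hαβ
  have h' := IsQuotient.conj e h
  rw [image_univ, e.surjective.range_eq] at h'
  obtain ⟨π, hπ⟩ := IsQuotient.exists_cover isOpen_univ h'
  refine hasInfDimFamilyModConformal_of_translations hπ (l := Complex.reCLM) (z₀ := 1)
    (by simp) 0 ?_
  rintro _ ⟨g, ⟨k, hg⟩, rfl⟩
  refine ⟨(e (τ k)).1, (e (τ k)).2, ⟨if k = 0 then 1 else 0, ?_⟩, fun z w => ?_⟩
  · rw [Complex.reCLM_apply, he, hre]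
    simp [Finsupp.single_apply]
  · change e (g (e.symm (z, w))) = _
    rw [hg, map_add, e.apply_symm_apply]
    refine Prod.ext ?_ ?_ <;> simp

lemma IsPrimaryKodaira.hasInfDimFamilyModConformal (h : IsPrimaryKodaira M) :
    HasInfDimFamilyModConformal (compatibleNonLCPK M) := by
  obtain ⟨a, b, h0, h1, h2, -, -, h⟩ := h
  obtain ⟨π, hπ⟩ := IsQuotient.exists_cover isOpen_univ h
  -- The real linear form with values `1`, `0` on `a 2`, `a 3`.
  let l : ℂ →L[ℝ] ℝ := (a 2 * (starRingEnd ℂ) (a 3)).im⁻¹ •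
    Complex.imCLM.comp ((starRingEnd ℂ) (a 3) • ContinuousLinearMap.id ℝ ℂ)
  have hl : ∀ z, l z = (a 2 * (starRingEnd ℂ) (a 3)).im⁻¹ * ((starRingEnd ℂ) (a 3) * z).im :=
    fun z => rfl
  have hl2 : l (a 2) = 1 := by rw [hl, mul_comm _ (a 2), inv_mul_cancel₀ h2]
  have hl3 : l (a 3) = 0 := by
    rw [hl, mul_comm _ (a 3), Complex.mul_conj, Complex.ofReal_im, mul_zero]
  refine hasInfDimFamilyModConformal_of_translations hπ hl2 1 ?_
  rintro g ⟨k, hg⟩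
  refine ⟨a k, b k, ?_, fun z w => by rw [hg, Complex.ofReal_one, one_mul]⟩
  fin_cases k
  · exact ⟨0, by simp [h0]⟩
  · exact ⟨0, by simp [h1]⟩
  · exact ⟨1, by simpa using hl2⟩
  · exact ⟨0, by simpa using hl3⟩

lemma IsInoueSPlus.hasInfDimFamilyModConformal (h : IsInoueSPlus M) :
    HasInfDimFamilyModConformal (compatible M) := by
  obtain ⟨N, α, a, b, c, m, r, t, -, hα, -, -, -, -, -, -, h⟩ := h
  -- The two coordinates are exchanged, so that the half-plane comes first.
  obtain ⟨e, he⟩ := exists_linearEquiv (α := 0) (β := 1) (γ := 1) (δ := 0) (by simp)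
  simp only [zero_mul, one_mul, zero_add, add_zero] at he
  have hes : ∀ p, e.symm p = (p.2, p.1) := fun p => by
    rw [e.symm_apply_eq, he]
  have h' := IsQuotient.conj e h
  have hU : e '' {p | 0 < p.2.im} = {p | 0 < p.1.im} := by
    ext p
    constructor
    · rintro ⟨x, hx, rfl⟩
      rw [he]
      exact hx
    · exact fun hp => ⟨(p.2, p.1), hp, he _⟩
  rw [hU] at h'
  have hW : IsOpen {z : ℂ | 0 < z.im} := isOpen_lt continuous_const Complex.continuous_im
  obtain ⟨π, hπ⟩ := IsQuotient.exists_cover (hW.preimage continuous_fst) h'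
  have hlog : 0 < Real.log α := Real.log_pos hα
  have him : ContDiff ℝ ∞ Complex.im := Complex.imCLM.contDiff
  have hinv : ContDiffOn ℝ ∞ (fun z : ℂ => z.im⁻¹) {z | 0 < z.im} :=
    him.contDiffOn.inv fun z hz => ne_of_gt hz
  have ht : ContDiffOn ℝ ∞ (fun z : ℂ => Real.cos (2 * Real.pi * (Real.log z.im / Real.log α)))
      {z | 0 < z.im} :=
    (contDiffOn_const.mul ((him.contDiffOn.log fun z hz => ne_of_gt hz).div_const _)).cos
  refine hasInfDimFamilyModConformal_of_model hπ hW (fun p hp => hp) (q := fun _ => 1)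
    (t := fun z => Real.cos (2 * Real.pi * (Real.log z.im / Real.log α)))
    (κ := fun z => z.im⁻¹) (φ₀ := fun _ => 0) (c := fun p => p.1.im⁻¹) contDiffOn_const ht hinv
    contDiffOn_const (hinv.comp contDiffOn_fst fun p hp => hp) (fun z _ => by simp)
    (fun p hp => inv_ne_zero (ne_of_gt hp)) (fun p hp => inv_ne_zero (ne_of_gt hp)) ?_ ?_
    fun F σ hσ φ hS hg => rfl
  · refine (Icc_infinite (show (-1 : ℝ) < 1 by norm_num)).mono fun y hy => ?_
    refine ⟨(Real.exp (Real.arccos y / (2 * Real.pi) * Real.log α) * Complex.I, 0), ?_, ?_⟩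
    · change 0 < Complex.im _
      rw [Complex.im_ofReal_mul, Complex.I_im, mul_one]
      exact Real.exp_pos _
    · simp only [Complex.im_ofReal_mul, Complex.I_im, mul_one, Real.log_exp]
      rw [mul_div_cancel_right₀ _ hlog.ne', mul_div_cancel₀ _ (by positivity),
        Real.cos_arccos hy.1 hy.2]
  · intro P
    rintro _ ⟨g, (hg | ⟨k, hg⟩) | hg, rfl⟩
    all_goals
      have hge : ∀ z w : ℂ, ((e.symm.toEquiv.trans g).trans e.toEquiv) (z, w) =
          ((g (w, z)).2, (g (w, z)).1) := fun z w => by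
        change e (g (e.symm (z, w))) = _
        rw [hes, he]
      dsimp only
      generalize (e.symm.toEquiv.trans g).trans e.toEquiv = g' at hge ⊢
    · have hα0 : 0 < α := by linarith
      replace hge : ∀ z w : ℂ, g' (z, w) = (α * z, w + t) := fun z w => by rw [hge, hg]
      have hge1 : ∀ p : C2, (g' p).1 = _ := fun p => congrArg Prod.fst (hge p.1 p.2)
      refine isAffineSymm_triangular (fun p => ?_) α 0 0 t (fun z w => ?_) (fun _ _ => rfl)
        (fun _ _ => by simp) (fun p hp => ?_) (fun p hp => ?_)
      · change 0 < p.1.im ↔ 0 < (g' p).1.im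
        rw [hge1, Complex.im_ofReal_mul, mul_pos_iff_of_pos_left hα0]
      · rw [hge]
        simp
      · have hp' : 0 < p.1.im := hp
        rw [hge1, Complex.im_ofReal_mul, Real.log_mul hα0.ne' hp'.ne', add_div, div_self hlog.ne',
          add_comm (1 : ℝ), mul_add (2 * Real.pi), mul_one, Real.cos_add_two_pi]
        simp
        field_simp
      · rw [hge1, Complex.im_ofReal_mul]
        field_simp
    · replace hge : ∀ z w : ℂ, g' (z, w) = (z + a k, w + b k * z + c k) := fun z w => by rw [hge, hg]
      have hge1 : ∀ p : C2, (g' p).1 = _ := fun p => congrArg Prod.fst (hge p.1 p.2)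
      refine isAffineSymm_triangular (fun p => ?_) 1 (b k) (a k) (c k) (fun z w => ?_)
        (fun _ _ => rfl) (fun _ _ => by simp) (fun p hp => ?_) (fun p hp => ?_)
      · change 0 < p.1.im ↔ 0 < (g' p).1.im
        rw [hge1, Complex.add_im, Complex.ofReal_im, add_zero]
      · rw [hge]
        simp
      · rw [hge1, Complex.add_im, Complex.ofReal_im, add_zero]
        simp
      · rw [hge1, Complex.add_im, Complex.ofReal_im, add_zero, mul_one]
    · replace hge : ∀ z w : ℂ, g' (z, w) = (z, w + ((b 0 * a 1 - b 1 * a 0) / r : ℝ)) := fun z w => by rw [hge, hg]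
      have hge1 : ∀ p : C2, (g' p).1 = _ := fun p => congrArg Prod.fst (hge p.1 p.2)
      refine isAffineSymm_triangular (fun p => ?_) 1 0 0 (((b 0 * a 1 - b 1 * a 0) / r : ℝ) : ℂ)
        (fun z w => ?_)
        (fun _ _ => rfl) (fun _ _ => by simp) (fun p hp => ?_) (fun p hp => ?_)
      · change 0 < p.1.im ↔ 0 < (g' p).1.im
        rw [hge1]
      · rw [hge]
        simp
      · rw [hge1]
        simp
      · rw [hge1, mul_one]

lemma IsRealProperlyElliptic.hasInfDimFamily [T2Space M] (h : IsRealProperlyElliptic M) :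
    HasInfDimFamily (compatible M) := by
  obtain ⟨Γ, hΓ, h⟩ := h
  -- Both sets lie in `p.2 ≠ 0`, the first one because `p.1 / 0 = 0`.
  have hU : {p : C2 | 0 < (p.1 / p.2).im} = {p | 0 < (p.1 * (starRingEnd ℂ) p.2).im} := by
    ext p
    rw [mem_ofPred_eq, mem_ofPred_eq, div_eq_mul_inv, Complex.inv_def, ← mul_assoc,
      Complex.im_mul_ofReal]
    rcases eq_or_ne p.2 0 with h0 | h0
    · simp [h0]
    · exact mul_pos_iff_of_pos_right (inv_pos.2 (Complex.normSq_pos.2 h0))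
  rw [hU] at h
  have hs : ContDiff ℝ ∞ fun p : C2 => (p.1 * (starRingEnd ℂ) p.2).im :=
    Complex.imCLM.contDiff.comp (contDiff_fst.mul (Complex.conjCLE.contDiff.comp contDiff_snd))
  obtain ⟨π, hπ⟩ := IsQuotient.exists_cover (isOpen_lt continuous_const hs.continuous) h
  have : Nonempty M := ⟨π 0⟩
  obtain ⟨f, hf, hfr⟩ := exists_contMDiff_infinite_range (M := M)
  refine hasInfDimFamily_of_real hπ (c₀ := fun p => (p.1 * (starRingEnd ℂ) p.2).im⁻¹)
    (hs.contDiffOn.inv fun p hp => ne_of_gt hp) (fun p hp => inv_ne_zero (ne_of_gt hp)) ?_ hf hfr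
    fun Q hQ => hQ
  rintro g ⟨L, hL, hg⟩
  have hd := hΓ L hL
  rw [Matrix.det_fin_two] at hd
  have him : ∀ p : C2, ((g p).1 * (starRingEnd ℂ) (g p).2).im =
      (L 0 0 * L 1 1 - L 0 1 * L 1 0) * (p.1 * (starRingEnd ℂ) p.2).im := by
    intro p
    have h1 := hg p.1 p.2
    rw [Prod.mk.eta] at h1
    rw [h1]
    simp
    ring
  refine ⟨L 0 0, L 0 1, L 1 0, L 1 1, fun p => ?_, hg, fun p hp => ?_⟩
  · rw [mem_ofPred_eq, mem_ofPred_eq, him, mul_pos_iff_of_pos_left hd]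
  · rw [him]
    field_simp

lemma IsQuaternionicHopf.hasInfDimFamily [T2Space M] (h : IsQuaternionicHopf M) :
    HasInfDimFamily (compatible M) := by
  obtain ⟨a, ha, h⟩ := h
  -- In the coordinates `(z₁ + z₂) / 2`, `(z₁ - z₂) / 2i` the generator is the real matrix of the
  -- similarity `a` of the plane, with determinant `|a|²`.
  obtain ⟨e, he⟩ := exists_linearEquiv (α := 1 / 2) (β := 1 / 2) (γ := -Complex.I / 2)
    (δ := Complex.I / 2) (by ring_nf; simp)
  have h' := IsQuotient.conj e h
  have hU : e '' {0}ᶜ = {0}ᶜ := by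
    rw [image_compl_eq e.bijective, image_singleton, map_zero]
  rw [hU] at h'
  obtain ⟨π, hπ⟩ := IsQuotient.exists_cover isOpen_compl_singleton h'
  have : Nonempty M := ⟨π 0⟩
  obtain ⟨f, hf, hfr⟩ := exists_contMDiff_infinite_range (M := M)
  have hsm : ContDiff ℝ ∞ fun p : C2 => Complex.normSq p.1 + Complex.normSq p.2 := by
    have h1 : ContDiff ℝ ∞ Complex.re := Complex.reCLM.contDiff
    have h2 : ContDiff ℝ ∞ Complex.im := Complex.imCLM.contDiff
    simp only [Complex.normSq_apply]
    fun_prop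
  have hn0 : ∀ p ∈ ({0}ᶜ : Set C2), Complex.normSq p.1 + Complex.normSq p.2 ≠ 0 := by
    intro p hp h0
    have h2 := Complex.normSq_nonneg p.1
    have h3 := Complex.normSq_nonneg p.2
    exact hp (Prod.ext (Complex.normSq_eq_zero.1 (by linarith))
      (Complex.normSq_eq_zero.1 (by linarith)))
  refine hasInfDimFamily_of_real hπ
    (c₀ := fun p => (Complex.normSq p.1 + Complex.normSq p.2)⁻¹)
    (hsm.contDiffOn.inv hn0) (fun p hp => inv_ne_zero (hn0 p hp)) ?_ hf hfr fun Q hQ => hQ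
  rintro _ ⟨g, hg, rfl⟩
  have hge : ∀ z w : ℂ, ((e.symm.toEquiv.trans g).trans e.toEquiv) (z, w) =
      (a.re * z + (-a.im : ℝ) * w, a.im * z + a.re * w) := by
    intro z w
    change e (g (e.symm (z, w))) = _
    obtain ⟨⟨x, y⟩, hxy⟩ := e.surjective (z, w)
    rw [← hxy, e.symm_apply_apply, hg, he]
    rw [he] at hxy
    obtain ⟨rfl, rfl⟩ := Prod.ext_iff.1 hxy
    have h1 : (starRingEnd ℂ) a = a.re - a.im * Complex.I := by
      apply Complex.ext <;> simp
    have h2 := (Complex.re_add_im a).symm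
    refine Prod.ext ?_ ?_
    · push_cast
      linear_combination x / 2 * h2 + y / 2 * h1
    · push_cast
      linear_combination -Complex.I / 2 * x * h2 + Complex.I / 2 * y * h1 -
        (a.im : ℂ) / 2 * (x + y) * Complex.I_sq
  dsimp only
  generalize (e.symm.toEquiv.trans g).trans e.toEquiv = g' at hge ⊢
  have ha0 : a.re * a.re - -a.im * a.im ≠ 0 := by
    have h1 : Complex.normSq a ≠ 0 := by
      rw [Ne, Complex.normSq_eq_zero, ← norm_eq_zero]
      linarith
    rw [Complex.normSq_apply] at h1
    rwa [neg_mul, sub_neg_eq_add]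
  refine ⟨a.re, -a.im, a.im, a.re, fun p => ?_, hge, fun p hp => ?_⟩
  · have h0 : g' 0 = 0 := (hge 0 0).trans (Prod.ext (by simp) (by simp))
    rw [mem_compl_singleton_iff, mem_compl_singleton_iff, Ne, Ne, ← g'.injective.eq_iff, h0]
  · have h1 : Complex.normSq (g' p).1 + Complex.normSq (g' p).2 =
        (a.re * a.re - -a.im * a.im) * (Complex.normSq p.1 + Complex.normSq p.2) := by
      have h2 := hge p.1 p.2
      rw [Prod.mk.eta] at h2
      rw [h2]
      simp only [Complex.normSq_apply]
      simp
      ring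
    rw [h1, mul_inv, mul_right_comm, inv_mul_cancel₀ ha0, one_mul]

end Surfaces

end ParaHH

end

theorem theorem9 (M : Type*) [TopologicalSpace M] [T2Space M] [CompactSpace M]
    [ChartedSpace ParaHH.C2 M] [IsManifold 𝓘(ℂ, ParaHH.C2) ω M] :
    (ParaHH.IsComplexTorus M ∨ ParaHH.IsPrimaryKodaira M ∨ ParaHH.IsInoueSPlus M ∨
        ParaHH.IsRealProperlyElliptic M ∨ ParaHH.IsQuaternionicHopf M →
      ParaHH.HasInfDimFamily (ParaHH.compatible M)) ∧
    (ParaHH.IsComplexTorus M ∨ ParaHH.IsPrimaryKodaira M ∨ ParaHH.IsInoueSPlus M →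
      ParaHH.HasInfDimFamilyModConformal (ParaHH.compatible M)) ∧
    (ParaHH.IsComplexTorus M ∨ ParaHH.IsPrimaryKodaira M →
      ParaHH.HasInfDimFamilyModConformal (ParaHH.compatibleNonLCPK M)) := by
  have h3 : ParaHH.IsComplexTorus M ∨ ParaHH.IsPrimaryKodaira M →
      ParaHH.HasInfDimFamilyModConformal (ParaHH.compatibleNonLCPK M) := by
    rintro (h | h)
    · exact h.hasInfDimFamilyModConformal
    · exact h.hasInfDimFamilyModConformal
  have h2 : ParaHH.IsComplexTorus M ∨ ParaHH.IsPrimaryKodaira M ∨ ParaHH.IsInoueSPlus M →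
      ParaHH.HasInfDimFamilyModConformal (ParaHH.compatible M) := by
    rintro (h | h | h)
    · exact (h3 (.inl h)).mono fun _ hQ => hQ.1
    · exact (h3 (.inr h)).mono fun _ hQ => hQ.1
    · exact h.hasInfDimFamilyModConformal
  refine ⟨?_, h2, h3⟩
  rintro (h | h | h | h | h)
  · exact (h2 (.inl h)).hasInfDimFamily
  · exact (h2 (.inr (.inl h))).hasInfDimFamily
  · exact (h2 (.inr (.inr h))).hasInfDimFamily
  · exact h.hasInfDimFamily
  · exact h.hasInfDimFamily
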